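/- Fix $0<H<1$ and $\mathbb K\in\{\mathbb R,\mathbb C\}$. Let $\mathcal H_H$ be the Hilbert space completion of the $\mathbb K$-valued Schwartz space $\mathcal S(\mathbb R)$ with respect to the positive semidefinite form $$\langle \xi,\eta\rangle_H=-\tfrac12\int_{\mathbb R}\int_{\mathbb R}\overline{\xi'(x)}\,\eta'(y)\,|x-y|^{2H}\,dx\,dy .$$ A function $f\in L^{1/H}(\mathbb R)$ is regarded as an element of $\mathcal H_H$ if there is a (necessarily unique) vector of $\mathcal H_H$ whose scalar product with every $\eta\in\mathcal S(\mathbb R)$ is $$\langle \eta,f\rangle_H=H\int_{\mathbb R}\Big(\int_{\mathbb R}\overline{\eta'(x)}\,\mathrm{sgn}(y-x)|x-y|^{2H-1}\,dx\Big)f(y)\,dy ;$$ for $f \in \mathcal S(\mathbb R)$ this is the form above, by partial integration. The group $GL_2(\mathbb R)$ acts on $\mathbb R_\infty=\mathbb R\cup\{\infty\}$ by Möbius transformations $g.x=\frac{ax+b}{cx+d}$; this factors through an action of $PGL_2(\mathbb R)=GL_2(\mathbb R)/\mathbb R^\times$. For $g\in GL_2(\mathbb R)$ with $g^{-1}=\begin{pmatrix}a&b\\c&d\end{pmatrix}$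 put $$(U^H_g\xi)(x)=\mathrm{sgn}(\det g)\,\frac{|ad-bc|^{H}}{|cx+d|^{2H}}\,\xi\Big(\frac{ax+b}{cx+d}\Big);$$ this depends only on the class of $g$ in $PGL_2(\mathbb R)$. Let $C^H(s,t)=\frac12(|s|^{2H}+|t|^{2H}-|s-t|^{2H})$ be the covariance kernel of fractional Brownian motion $(B^H_t)_{t\in\mathbb R}$ with Hurst index $H$. For mutually different $\alpha,\beta,\gamma\in\mathbb R_\infty$ put $C^H_{\alpha,\beta,\gamma}(s,t)=C^H(g.s,g.t)$ for $s,t\ne\gamma$, where $g$ maps $(\alpha,\beta,\gamma)$ to $(0,1,\infty)$, and let $$C^H_{\alpha,\gamma}(s,t)=\frac{C^H_{\alpha,\beta,\gamma}(s,t)}{\sqrt{C^H_{\alpha,\beta,\gamma}(s,s)\,C^H_{\alpha,\beta,\gamma}(t,t)}},\qquad s,t\in\mathbb R_\infty\setminus\{\alpha,\gamma\}.$$ Theorem. Let $\alpha\neq\gamma$ in $\mathbb R_\infty$. For every $t\in\mathbb R_\infty\setminus\{\alpha,\gamma\}$ there is a unique $g_t\in PGL_2(\mathbb R)$ with $(g_t.\alpha,g_t.t,g_t.\gamma)=(0,1,\infty)$.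 Put $f_t^{\alpha,\gamma}=U^H_{g_t^{-1}}\chi_{[0,1]}$. If $g_t$ is represented by the matrix $\begin{pmatrix}a&b\\c&d\end{pmatrix}$ with determinant $\det g_t$, then $$f_t^{\alpha,\gamma}(x)=\mathrm{sgn}(\det g_t)\frac{|\det g_t|^H}{|cx+d|^{2H}}\,\chi_{g_t^{-1}([0,1])}(x)$$ (read as $0$ where $cx+d=0$). Moreover, the following hold. (a) All functions $f_t^{\alpha,\gamma}$ are elements of $\mathcal H_H$, and they are unit vectors. (b) $\langle f_s^{\alpha,\gamma},f_t^{\alpha,\gamma}\rangle_{\mathcal H_H}=C^H_{\alpha,\gamma}(s,t)$ for all $s,t\in\mathbb R_\infty\setminus\{\alpha,\gamma\}$, where $C^H_{\alpha,\gamma}$ may be formed with any $\beta\in\mathbb R_\infty\setminus\{\alpha,\gamma\}$. Consequently, if $(\phi(v))_{v\in\mathcal H_H}$ is a centered $\mathbb K$-valued Gaussian process on a probability space with $\mathbb E(\phi(v)\overline{\phi(w)})=\langle v,w\rangle_{\mathcal H_H}$, then $(\phi(f_t^{\alpha,\gamma}))_{t\neq\alpha,\gamma}$ is a centered Gaussian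 process with covariance kernel $C^H_{\alpha,\gamma}$. (c) The realization is $GL_2(\mathbb R)$-covariant: for $h\in GL_2(\mathbb R)$ and $s,t\in\mathbb R_\infty\setminus\{\alpha,\gamma\}$ one has $U^H_h f_t^{\alpha,\gamma}=f_{h.t}^{h.\alpha,h.\gamma}$ almost everywhere and $C^H_{h.\alpha,h.\gamma}(h.s,h.t)=C^H_{\alpha,\gamma}(s,t)$ (the kernel on the left being formed with $h.\beta$ if the one on the right is formed with $\beta$). (d) For $(\alpha,\gamma)=(0,\infty)$ the kernel is that of normalized fractional Brownian motion $|t|^{-H}B^H_t$: $C^H_{0,\infty}(s,t)=|s|^{-H}|t|^{-H}C^H(s,t)$ for $s,t\in\mathbb R^\times$. -/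

import Mathlib

open MeasureTheory Set
open scoped SchwartzMap ComplexConjugate MatrixGroups

namespace FracBM

section form
variable {𝕜 : Type*} [RCLike 𝕜]

/-- The hermitian form
`⟨ξ, η⟩_H = -(1/2) ∫ ∫ conj (ξ' x) * η' y * |x - y| ^ (2 H) dx dy` on the Schwartz space. -/
noncomputable def hForm (H : ℝ) (ξ η : 𝓢(ℝ, 𝕜)) : 𝕜 :=
  -(1 / 2) * ∫ x : ℝ, ∫ y : ℝ, conj (deriv ξ x) * deriv η y * ((|x - y| ^ (2 * H) : ℝ) : 𝕜)

theorem integrable_deriv_mul (ξ : 𝓢(ℝ, 𝕜)) :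
    Integrable fun x : ℝ => (1 + |x|) ^ 2 * ‖deriv ξ x‖ := by
  have h0 := (SchwartzMap.derivCLM 𝕜 𝕜 ξ).integrable_pow_mul volume 0
  have h1 := (SchwartzMap.derivCLM 𝕜 𝕜 ξ).integrable_pow_mul volume 1
  have h2 := (SchwartzMap.derivCLM 𝕜 𝕜 ξ).integrable_pow_mul volume 2
  refine ((h0.add (h1.const_mul 2)).add h2).congr (Filter.Eventually.of_forall fun x => ?_)
  simp only [Pi.add_apply, SchwartzMap.derivCLM_apply, Real.norm_eq_abs]
  ring

theorem continuous_deriv (ξ : 𝓢(ℝ, 𝕜)) : Continuous (deriv ξ) :=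
  (SchwartzMap.derivCLM 𝕜 𝕜 ξ).continuous

theorem abs_sub_rpow_le {H : ℝ} (h0 : 0 < H) (h1 : H < 1) (x y : ℝ) :
    |x - y| ^ (2 * H) ≤ (1 + |x|) ^ 2 * (1 + |y|) ^ 2 := by
  have hx := abs_nonneg x
  have hy := abs_nonneg y
  have hb : |x - y| ≤ (1 + |x|) * (1 + |y|) := by
    have := abs_sub x y
    nlinarith [mul_nonneg hx hy]
  have h2 : 1 ≤ (1 + |x|) * (1 + |y|) := by nlinarith [mul_nonneg hx hy]
  calc |x - y| ^ (2 * H) ≤ ((1 + |x|) * (1 + |y|)) ^ (2 * H) :=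
        Real.rpow_le_rpow (abs_nonneg _) hb (by linarith)
    _ ≤ ((1 + |x|) * (1 + |y|)) ^ ((2 : ℕ) : ℝ) :=
        Real.rpow_le_rpow_of_exponent_le h2 (by push_cast; linarith)
    _ = _ := by rw [Real.rpow_natCast]; ring

theorem integrable_hForm {H : ℝ} (h0 : 0 < H) (h1 : H < 1) (ξ η : 𝓢(ℝ, 𝕜)) :
    Integrable (fun p : ℝ × ℝ =>
      conj (deriv ξ p.1) * deriv η p.2 * ((|p.1 - p.2| ^ (2 * H) : ℝ) : 𝕜))
      (volume.prod volume) := by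
  refine ((integrable_deriv_mul ξ).mul_prod (integrable_deriv_mul η)).mono' ?_
    (Filter.Eventually.of_forall fun p => ?_)
  · refine Continuous.aestronglyMeasurable ?_
    have hc : Continuous fun p : ℝ × ℝ => |p.1 - p.2| ^ (2 * H) :=
      (continuous_abs.comp (continuous_fst.sub continuous_snd)).rpow_const
        fun _ => Or.inr (by linarith)
    exact ((RCLike.continuous_conj.comp ((continuous_deriv ξ).comp continuous_fst)).mul
      ((continuous_deriv η).comp continuous_snd)).mul (RCLike.continuous_ofReal.comp hc)
  · rw [norm_mul, norm_mul, RCLike.norm_conj, RCLike.norm_ofReal,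
      abs_of_nonneg (Real.rpow_nonneg (abs_nonneg _) _)]
    calc ‖deriv ξ p.1‖ * ‖deriv η p.2‖ * |p.1 - p.2| ^ (2 * H)
        ≤ ‖deriv ξ p.1‖ * ‖deriv η p.2‖ * ((1 + |p.1|) ^ 2 * (1 + |p.2|) ^ 2) := by
          gcongr; exact abs_sub_rpow_le h0 h1 _ _
      _ = _ := by ring

theorem hForm_eq_prod {H : ℝ} (h0 : 0 < H) (h1 : H < 1) (ξ η : 𝓢(ℝ, 𝕜)) :
    hForm H ξ η = -(1 / 2) * ∫ p : ℝ × ℝ,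
      conj (deriv ξ p.1) * deriv η p.2 * ((|p.1 - p.2| ^ (2 * H) : ℝ) : 𝕜)
        ∂(volume.prod volume) := by
  rw [hForm, integral_prod _ (integrable_hForm h0 h1 ξ η)]

theorem hForm_conj_symm {H : ℝ} (h0 : 0 < H) (h1 : H < 1) (ξ η : 𝓢(ℝ, 𝕜)) :
    conj (hForm H η ξ) = hForm H ξ η := by
  rw [hForm_eq_prod h0 h1, hForm_eq_prod h0 h1, map_mul, ← integral_conj,
    ← integral_prod_swap]
  congr 1
  · rw [map_neg, map_div₀, map_one, map_ofNat]
  · refine integral_congr_ae (Filter.Eventually.of_forall fun p => ?_)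
    simp only [map_mul, RCLike.conj_conj, RCLike.conj_ofReal, Prod.fst_swap, Prod.snd_swap,
      abs_sub_comm p.2 p.1]
    ring

theorem hForm_add_left {H : ℝ} (h0 : 0 < H) (h1 : H < 1) (ξ η ζ : 𝓢(ℝ, 𝕜)) :
    hForm H (ξ + η) ζ = hForm H ξ ζ + hForm H η ζ := by
  rw [hForm_eq_prod h0 h1, hForm_eq_prod h0 h1, hForm_eq_prod h0 h1, ← mul_add,
    ← integral_add (integrable_hForm h0 h1 ξ ζ) (integrable_hForm h0 h1 η ζ)]
  congr 1
  refine integral_congr_ae (Filter.Eventually.of_forall fun p => ?_)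
  have : deriv (⇑(ξ + η)) p.1 = deriv ξ p.1 + deriv η p.1 :=
    deriv_add ξ.differentiableAt η.differentiableAt
  simp only [this, map_add]
  ring

theorem hForm_smul_left (H : ℝ) (r : 𝕜) (ξ η : 𝓢(ℝ, 𝕜)) :
    hForm H (r • ξ) η = conj r * hForm H ξ η := by
  have : ∀ x, deriv (⇑(r • ξ)) x = r * deriv ξ x := fun x =>
    deriv_const_mul r ξ.differentiableAt
  simp only [hForm, this, map_mul, mul_assoc, integral_const_mul]
  ring

/-- The Lévy-Khintchine weight of `|a| ^ (2 H)` is integrable. -/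
theorem cos_weight_integrable {H : ℝ} (h0 : 0 < H) (h1 : H < 1) (a : ℝ) :
    IntegrableOn (fun l : ℝ => (1 - Real.cos (a * l)) * l ^ (-1 - 2 * H)) (Ioi 0) := by
  have hm : Measurable fun l : ℝ => (1 - Real.cos (a * l)) * l ^ (-1 - 2 * H) := by fun_prop
  rw [← Ioc_union_Ioi_eq_Ioi zero_le_one]
  refine IntegrableOn.union ?_ ?_
  · have hi : IntegrableOn (fun l : ℝ => a ^ 2 / 2 * l ^ (1 - 2 * H)) (Ioc 0 1) := by
      have := intervalIntegral.intervalIntegrable_rpow' (a := 0) (b := 1) (r := 1 - 2 * H)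
        (by linarith)
      rw [intervalIntegrable_iff_integrableOn_Ioc_of_le zero_le_one] at this
      exact this.const_mul _
    refine hi.mono' hm.aestronglyMeasurable ?_
    filter_upwards [ae_restrict_mem measurableSet_Ioc] with l hl
    have hp := Real.rpow_nonneg hl.1.le (-1 - 2 * H)
    have hc : 0 ≤ 1 - Real.cos (a * l) := by linarith [Real.cos_le_one (a * l)]
    rw [Real.norm_of_nonneg (mul_nonneg hc hp)]
    have h2 : l ^ (1 - 2 * H) = l ^ 2 * l ^ (-1 - 2 * H) := by
      rw [← Real.rpow_natCast, ← Real.rpow_add hl.1]; congr 1; push_cast; ring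
    rw [h2, ← mul_assoc]
    gcongr
    have := Real.one_sub_sq_div_two_le_cos (x := a * l)
    nlinarith
  · have hi : IntegrableOn (fun l : ℝ => 2 * l ^ (-1 - 2 * H)) (Ioi 1) :=
      (integrableOn_Ioi_rpow_of_lt (by linarith) one_pos).const_mul _
    refine hi.mono' hm.aestronglyMeasurable ?_
    filter_upwards [ae_restrict_mem measurableSet_Ioi] with l hl
    have hl0 : (0 : ℝ) < l := lt_trans one_pos hl
    have hp := Real.rpow_nonneg hl0.le (-1 - 2 * H)
    have hc : 0 ≤ 1 - Real.cos (a * l) := by linarith [Real.cos_le_one (a * l)]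
    rw [Real.norm_of_nonneg (mul_nonneg hc hp)]
    gcongr
    linarith [Real.neg_one_le_cos (a * l)]

/-- The constant in the Lévy-Khintchine formula for `|a| ^ (2 H)`. -/
noncomputable def cosConst (H : ℝ) : ℝ :=
  ∫ l in Ioi (0 : ℝ), (1 - Real.cos l) * l ^ (-1 - 2 * H)

theorem cosConst_pos {H : ℝ} (h0 : 0 < H) (h1 : H < 1) : 0 < cosConst H := by
  have hI := cos_weight_integrable h0 h1 1
  simp only [one_mul] at hI
  rw [cosConst, setIntegral_pos_iff_support_of_nonneg_ae _ hI]
  · refine lt_of_lt_of_le ?_ (measure_mono (s := Ioo 0 1) fun l hl => ⟨?_, hl.1⟩)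
    · simp
    · refine mul_ne_zero (sub_ne_zero.mpr (ne_of_gt ?_)) (Real.rpow_pos_of_pos hl.1 _).ne'
      rw [← Real.cos_zero]
      exact Real.cos_lt_cos_of_nonneg_of_le_pi le_rfl (by linarith [hl.2, Real.pi_gt_three]) hl.1
  · filter_upwards [ae_restrict_mem measurableSet_Ioi] with l hl
    exact mul_nonneg (by linarith [Real.cos_le_one l]) (Real.rpow_nonneg (le_of_lt hl) _)

theorem integral_cos_weight {H : ℝ} (h0 : 0 < H) (a : ℝ) :
    ∫ l in Ioi (0 : ℝ), (1 - Real.cos (a * l)) * l ^ (-1 - 2 * H)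
      = |a| ^ (2 * H) * cosConst H := by
  rcases eq_or_ne a 0 with rfl | ha
  · simp [Real.zero_rpow (by linarith : 2 * H ≠ 0)]
  have hb : 0 < |a| := abs_pos.mpr ha
  have key := integral_comp_mul_left_Ioi (fun l : ℝ => (1 - Real.cos l) * l ^ (-1 - 2 * H)) 0 hb
  rw [mul_zero, ← cosConst] at key
  have hco : ∀ l ∈ Ioi (0 : ℝ), (1 - Real.cos (a * l)) * l ^ (-1 - 2 * H)
      = |a| ^ (1 + 2 * H) * ((1 - Real.cos (|a| * l)) * (|a| * l) ^ (-1 - 2 * H)) := by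
    intro l hl
    have h1 : Real.cos (|a| * l) = Real.cos (a * l) := by
      rcases abs_choice a with h | h <;> simp [h]
    have h2 : |a| ^ (1 + 2 * H) * |a| ^ (-1 - 2 * H) = 1 := by
      rw [← Real.rpow_add hb]; ring_nf; simp
    rw [h1, Real.mul_rpow hb.le (le_of_lt hl)]
    linear_combination (-(1 - Real.cos (a * l)) * l ^ (-1 - 2 * H)) * h2
  rw [setIntegral_congr_fun measurableSet_Ioi hco, integral_const_mul, key, smul_eq_mul,
    ← mul_assoc, Real.rpow_add hb, Real.rpow_one]
  field_simp

theorem integral_cos_kernel (f : ℝ → 𝕜) (hf : Integrable f) (h0 : ∫ x, f x = 0) (l w : ℝ) :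
    ∫ p : ℝ × ℝ, conj (f p.1) * f p.2 *
        (((1 - Real.cos ((p.1 - p.2) * l)) * w : ℝ) : 𝕜) ∂(volume.prod volume)
      = ((-w * (‖∫ x, f x * (Real.cos (x * l) : 𝕜)‖ ^ 2
          + ‖∫ x, f x * (Real.sin (x * l) : 𝕜)‖ ^ 2) : ℝ) : 𝕜) := by
  have hc : Integrable fun x => f x * (Real.cos (x * l) : 𝕜) := by
    refine hf.mul_bdd (c := 1) ?_ ?_
    · exact (Continuous.aestronglyMeasurable (by fun_prop))
    · exact Filter.Eventually.of_forall fun x => by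
        rw [RCLike.norm_ofReal]; exact Real.abs_cos_le_one _
  have hs : Integrable fun x => f x * (Real.sin (x * l) : 𝕜) := by
    refine hf.mul_bdd (c := 1) ?_ ?_
    · exact (Continuous.aestronglyMeasurable (by fun_prop))
    · exact Filter.Eventually.of_forall fun x => by
        rw [RCLike.norm_ofReal]; exact Real.abs_sin_le_one _
  have hconj : ∀ {g : ℝ → 𝕜}, Integrable g → Integrable fun x => conj (g x) := fun hg =>
    (RCLike.conjCLE (K := 𝕜)).toContinuousLinearMap.integrable_comp hg
  have e1 := (hconj hf).mul_prod hf
  have e2 := (hconj hc).mul_prod hc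
  have e3 := (hconj hs).mul_prod hs
  have hsplit : (fun p : ℝ × ℝ => conj (f p.1) * f p.2 *
        (((1 - Real.cos ((p.1 - p.2) * l)) * w : ℝ) : 𝕜))
      = fun p : ℝ × ℝ => (w : 𝕜) * ((conj (f p.1) * f p.2
        - conj (f p.1 * (Real.cos (p.1 * l) : 𝕜)) * (f p.2 * (Real.cos (p.2 * l) : 𝕜)))
        - conj (f p.1 * (Real.sin (p.1 * l) : 𝕜)) * (f p.2 * (Real.sin (p.2 * l) : 𝕜))) := by
    funext p
    rw [sub_mul p.1, Real.cos_sub]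
    simp only [map_mul, RCLike.conj_ofReal]
    push_cast
    ring
  have e12 : Integrable (fun p : ℝ × ℝ => conj (f p.1) * f p.2
        - conj (f p.1 * (Real.cos (p.1 * l) : 𝕜)) * (f p.2 * (Real.cos (p.2 * l) : 𝕜)))
        (volume.prod volume) := e1.sub e2
  rw [hsplit, integral_const_mul, integral_sub e12 e3, integral_sub e1 e2,
    integral_prod_mul (fun x => conj (f x)) f,
    integral_prod_mul (fun x => conj (f x * (Real.cos (x * l) : 𝕜)))
      (fun x => f x * (Real.cos (x * l) : 𝕜)),
    integral_prod_mul (fun x => conj (f x * (Real.sin (x * l) : 𝕜)))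
      (fun x => f x * (Real.sin (x * l) : 𝕜)), integral_conj, integral_conj, integral_conj, h0,
    map_zero, zero_mul, RCLike.conj_mul, RCLike.conj_mul]
  push_cast
  ring

theorem hForm_nonneg {H : ℝ} (h0 : 0 < H) (h1 : H < 1) (ξ : 𝓢(ℝ, 𝕜)) :
    0 ≤ RCLike.re (hForm H ξ ξ) := by
  have hint : Integrable (deriv ξ) := (SchwartzMap.derivCLM 𝕜 𝕜 ξ).integrable
  have hzero : ∫ x, deriv ξ x = 0 :=
    integral_eq_zero_of_hasDerivAt_of_integrable (fun x => ξ.differentiableAt.hasDerivAt)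
      hint ξ.integrable
  let G : (ℝ × ℝ) → ℝ → 𝕜 := fun p l => conj (deriv ξ p.1) * deriv ξ p.2 *
        (((1 - Real.cos ((p.1 - p.2) * l)) * l ^ (-1 - 2 * H) : ℝ) : 𝕜)
  have hker : ∀ p : ℝ × ℝ, ∫ l in Ioi (0 : ℝ), G p l
      = (cosConst H : 𝕜) *
        (conj (deriv ξ p.1) * deriv ξ p.2 * ((|p.1 - p.2| ^ (2 * H) : ℝ) : 𝕜)) := by
    intro p
    simp only [G]
    rw [integral_const_mul, integral_ofReal, integral_cos_weight h0]
    push_cast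
    ring
  have hG : Integrable (Function.uncurry G)
      ((volume.prod volume).prod (volume.restrict (Ioi (0 : ℝ)))) := by
    have hms : AEStronglyMeasurable (Function.uncurry G)
        ((volume.prod volume).prod (volume.restrict (Ioi (0 : ℝ)))) := by
      have hd := (continuous_deriv ξ).measurable
      have : Measurable (Function.uncurry G) := by
        have hr : Measurable fun q : (ℝ × ℝ) × ℝ =>
          (1 - Real.cos ((q.1.1 - q.1.2) * q.2)) * q.2 ^ (-1 - 2 * H) := by fun_prop
        exact ((RCLike.continuous_conj.measurable.comp (hd.comp (by fun_prop))).mul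
          (hd.comp (by fun_prop))).mul (RCLike.measurable_ofReal.comp hr)
      exact this.aestronglyMeasurable
    rw [integrable_prod_iff hms]
    refine ⟨Filter.Eventually.of_forall fun p => ?_, ?_⟩
    · exact Integrable.const_mul (c := conj (deriv ξ p.1) * deriv ξ p.2)
        ((cos_weight_integrable h0 h1 (p.1 - p.2)).ofReal (𝕜 := 𝕜))
    · have hn : ∀ p : ℝ × ℝ, ∫ l in Ioi (0 : ℝ), ‖Function.uncurry G (p, l)‖
          = cosConst H * ‖conj (deriv ξ p.1) * deriv ξ p.2 *
              ((|p.1 - p.2| ^ (2 * H) : ℝ) : 𝕜)‖ := by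
        intro p
        have : ∀ l ∈ Ioi (0 : ℝ), ‖Function.uncurry G (p, l)‖
            = ‖conj (deriv ξ p.1) * deriv ξ p.2‖ *
              ((1 - Real.cos ((p.1 - p.2) * l)) * l ^ (-1 - 2 * H)) := by
          intro l hl
          simp only [Function.uncurry, G]
          rw [norm_mul, RCLike.norm_ofReal, abs_of_nonneg]
          exact mul_nonneg (by linarith [Real.cos_le_one ((p.1 - p.2) * l)])
            (Real.rpow_nonneg (le_of_lt hl) _)
        rw [setIntegral_congr_fun measurableSet_Ioi this, integral_const_mul,
          integral_cos_weight h0, norm_mul (conj (deriv ξ p.1) * deriv ξ p.2), RCLike.norm_ofReal,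
          abs_of_nonneg (Real.rpow_nonneg (abs_nonneg (p.1 - p.2)) _)]
        ring
      simp only [hn]
      exact (integrable_hForm h0 h1 ξ ξ).norm.const_mul _
  have hswap := integral_integral_swap hG
  simp only [hker, integral_const_mul] at hswap
  have hneg : ∀ l : ℝ, ∫ p : ℝ × ℝ, G p l ∂(volume.prod volume)
      = ((-(l ^ (-1 - 2 * H)) * (‖∫ x, deriv ξ x * (Real.cos (x * l) : 𝕜)‖ ^ 2
          + ‖∫ x, deriv ξ x * (Real.sin (x * l) : 𝕜)‖ ^ 2) : ℝ) : 𝕜) := fun l =>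
    integral_cos_kernel (deriv ξ) hint hzero l _
  simp only [hneg] at hswap
  rw [integral_ofReal] at hswap
  have hle : ∫ l in Ioi (0 : ℝ), (-(l ^ (-1 - 2 * H)) *
      (‖∫ x, deriv ξ x * (Real.cos (x * l) : 𝕜)‖ ^ 2
          + ‖∫ x, deriv ξ x * (Real.sin (x * l) : 𝕜)‖ ^ 2)) ≤ 0 := by
    refine setIntegral_nonpos measurableSet_Ioi fun l hl => ?_
    have := Real.rpow_nonneg (le_of_lt hl) (-1 - 2 * H)
    exact mul_nonpos_of_nonpos_of_nonneg (by linarith) (by positivity)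
  have hre := congrArg RCLike.re hswap
  rw [RCLike.re_ofReal_mul, RCLike.ofReal_re] at hre
  have hc := cosConst_pos h0 h1
  rw [hForm_eq_prod h0 h1]
  have h12 : (-(1 / 2) : 𝕜) = ((-(1 / 2) : ℝ) : 𝕜) := by push_cast; rfl
  rw [h12, RCLike.re_ofReal_mul]
  have : RCLike.re (∫ p : ℝ × ℝ, conj (deriv ξ p.1) * deriv ξ p.2 *
      ((|p.1 - p.2| ^ (2 * H) : ℝ) : 𝕜) ∂(volume.prod volume)) ≤ 0 := by
    by_contra hcon
    push Not at hcon
    nlinarith [mul_pos hc hcon]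
  linarith

end form

/-! ### The Hilbert space -/

section space
variable (𝕜 : Type*) [RCLike 𝕜] (H : Ioo (0 : ℝ) 1)

/-- The Schwartz space, to be equipped with the seminorm coming from `hForm H`. -/
def SchwartzH (𝕜 : Type*) [RCLike 𝕜] (_H : Ioo (0 : ℝ) 1) : Type _ := 𝓢(ℝ, 𝕜)

noncomputable instance SchwartzH.instAddCommGroup : AddCommGroup (SchwartzH 𝕜 H) :=
  inferInstanceAs (AddCommGroup 𝓢(ℝ, 𝕜))

noncomputable instance SchwartzH.instModule : Module 𝕜 (SchwartzH 𝕜 H) :=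
  inferInstanceAs (Module 𝕜 𝓢(ℝ, 𝕜))

/-- `hForm H` is a positive semidefinite hermitian form on the Schwartz space. -/
@[reducible] noncomputable def SchwartzH.core : PreInnerProductSpace.Core 𝕜 (SchwartzH 𝕜 H) where
  inner ξ η := hForm (𝕜 := 𝕜) (H : ℝ) ξ η
  conj_inner_symm ξ η := hForm_conj_symm H.2.1 H.2.2 (ξ : 𝓢(ℝ, 𝕜)) η
  re_inner_nonneg ξ := hForm_nonneg H.2.1 H.2.2 (ξ : 𝓢(ℝ, 𝕜))
  add_left ξ η ζ := hForm_add_left H.2.1 H.2.2 (ξ : 𝓢(ℝ, 𝕜)) η ζ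
  smul_left ξ η r := hForm_smul_left (H : ℝ) r (ξ : 𝓢(ℝ, 𝕜)) η

noncomputable instance SchwartzH.instSeminormedAddCommGroup :
    SeminormedAddCommGroup (SchwartzH 𝕜 H) :=
  @InnerProductSpace.Core.toSeminormedAddCommGroup 𝕜 _ _ _ _ (SchwartzH.core 𝕜 H)

noncomputable instance SchwartzH.instInnerProductSpace : InnerProductSpace 𝕜 (SchwartzH 𝕜 H) :=
  InnerProductSpace.ofCore (SchwartzH.core 𝕜 H)

/-- The Hilbert space `𝓗_H`: the (Hausdorff) completion of the Schwartz space with respect to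
`hForm H`. -/
abbrev HSpace : Type _ := UniformSpace.Completion (SchwartzH 𝕜 H)

variable {𝕜}

/-- The canonical map from the Schwartz space to `𝓗_H`. -/
noncomputable def toHSpace (ξ : 𝓢(ℝ, 𝕜)) : HSpace 𝕜 H :=
  ((show SchwartzH 𝕜 H from ξ : SchwartzH 𝕜 H) : UniformSpace.Completion (SchwartzH 𝕜 H))

theorem inner_toHSpace (ξ η : 𝓢(ℝ, 𝕜)) :
    inner 𝕜 (toHSpace H ξ) (toHSpace H η) = hForm (H : ℝ) ξ η :=
  UniformSpace.Completion.inner_coe (𝕜 := 𝕜) (E := SchwartzH 𝕜 H) _ _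

theorem denseRange_toHSpace : DenseRange (toHSpace H : 𝓢(ℝ, 𝕜) → HSpace 𝕜 H) :=
  UniformSpace.Completion.denseRange_coe (α := SchwartzH 𝕜 H)

variable {H}

/-- The function `f` is the element `v` of `𝓗_H`: its scalar product with every Schwartz function
`η` is the distributional extension
`⟨η, f⟩_H = H ∫ ∫ conj (η' x) * f y * sgn (y - x) * |x - y| ^ (2 H - 1) dx dy`
of `hForm` (integrate by parts in `y`). The integrability of `|f| ^ (1 / H)` makes all integrals
absolutely convergent, is preserved by the operators `mobiusOp`, and excludes adding constants
to `f`, which the scalar products cannot see when `H < 1 / 2`. -/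
def IsElement (f : ℝ → 𝕜) (v : HSpace 𝕜 H) : Prop :=
  MemLp f (ENNReal.ofReal (1 / (H : ℝ))) volume ∧
  ∀ η : 𝓢(ℝ, 𝕜), inner 𝕜 (toHSpace H η) v =
    ((H : ℝ) : 𝕜) * ∫ y : ℝ, (∫ x : ℝ, conj (deriv η x) *
      ((Real.sign (y - x) * |x - y| ^ (2 * (H : ℝ) - 1) : ℝ) : 𝕜)) * f y

end space

/-! ### Möbius transformations -/

theorem scalar_smul_onePoint (u : ℝˣ) (a : OnePoint ℝ) :
    Matrix.GeneralLinearGroup.scalar (Fin 2) u • a = a := by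
  induction a using OnePoint.rec with
  | infty => simp [OnePoint.smul_infty_eq_ite]
  | coe x => simp [OnePoint.smul_some_eq_ite]

/-- `PGL₂(ℝ)` acts on `ℝ ∪ {∞}` by Möbius transformations. -/
noncomputable instance instPGLAction : MulAction PGL(2, ℝ) (OnePoint ℝ) :=
  Matrix.ProjGenLinGroup.mulActionOfGL scalar_smul_onePoint

/-- `g` sends `(a, b, c)` to `(0, 1, ∞)`. -/
def Normalizes (g : PGL(2, ℝ)) (a b c : OnePoint ℝ) : Prop :=
  g • a = ((0 : ℝ) : OnePoint ℝ) ∧ g • b = ((1 : ℝ) : OnePoint ℝ) ∧ g • c = OnePoint.infty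

/-- The Möbius transformation sending the mutually different points `a, b, c` to `0, 1, ∞`. -/
noncomputable def mobius (a b c : OnePoint ℝ) : PGL(2, ℝ) :=
  Classical.epsilon fun g => Normalizes g a b c

section operators
variable {𝕜 : Type*} [RCLike 𝕜]

/-- The operator `U^H_g` on functions: with `g⁻¹ = (a b; c d)`, the function
`x ↦ sgn (det g) * |a d - b c| ^ H / |c x + d| ^ (2 H) * ξ ((a x + b) / (c x + d))`. -/
noncomputable def mobiusOp (H : ℝ) (g : GL (Fin 2) ℝ) (ξ : ℝ → 𝕜) : ℝ → 𝕜 := fun x =>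
  ((Real.sign g.1.det * (|g⁻¹.1.det| ^ H / |g⁻¹ 1 0 * x + g⁻¹ 1 1| ^ (2 * H)) : ℝ) : 𝕜) *
    ξ ((g⁻¹ 0 0 * x + g⁻¹ 0 1) / (g⁻¹ 1 0 * x + g⁻¹ 1 1))

theorem mobiusOp_mul_scalar (H : ℝ) (g : GL (Fin 2) ℝ) (u : ℝˣ) (ξ : ℝ → 𝕜) :
    mobiusOp H (g * Matrix.GeneralLinearGroup.scalar (Fin 2) u) ξ = mobiusOp H g ξ := by
  have aux : ∀ (w : ℝˣ) (k : GL (Fin 2) ℝ) (i j : Fin 2),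
      (Matrix.GeneralLinearGroup.scalar (Fin 2) w * k) i j = (w : ℝ) * k i j := by
    intro w k i j
    simp
  have hinv : (g * Matrix.GeneralLinearGroup.scalar (Fin 2) u)⁻¹
      = Matrix.GeneralLinearGroup.scalar (Fin 2) u⁻¹ * g⁻¹ := by
    rw [mul_inv_rev, map_inv]
  have hw : ((u⁻¹ : ℝˣ) : ℝ) ≠ 0 := u⁻¹.ne_zero
  have hu : (u : ℝ) ≠ 0 := u.ne_zero
  have hu2 : (0 : ℝ) < u * u := mul_self_pos.mpr hu
  have hdet : (g * Matrix.GeneralLinearGroup.scalar (Fin 2) u).1.det = (u * u : ℝ) * g.1.det := by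
    simp [Matrix.det_fin_two]
    ring
  have hsign : Real.sign ((u * u : ℝ) * g.1.det) = Real.sign g.1.det := by
    rcases lt_trichotomy g.1.det 0 with h | h | h
    · rw [Real.sign_of_neg h, Real.sign_of_neg (mul_neg_of_pos_of_neg hu2 h)]
    · rw [h, mul_zero]
    · rw [Real.sign_of_pos h, Real.sign_of_pos (mul_pos hu2 h)]
  funext x
  simp only [mobiusOp, hdet, hsign, hinv]
  generalize g⁻¹ = k
  generalize u⁻¹ = w at hw
  have hdet2 : (Matrix.GeneralLinearGroup.scalar (Fin 2) w * k).1.det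
      = |(w : ℝ)| ^ 2 * k.1.det := by
    rw [sq_abs, Matrix.det_fin_two, Matrix.det_fin_two]
    have := aux w k
    simp only [this]
    ring
  have hrw : |(w : ℝ)| ^ (2 * H) = (|(w : ℝ)| ^ 2) ^ H := by
    rw [Real.rpow_mul (abs_nonneg _)]
    norm_num
  have hpos : 0 < (|(w : ℝ)| ^ 2) ^ H := Real.rpow_pos_of_pos (by positivity) _
  simp only [aux, hdet2]
  have l1 : (w : ℝ) * k 1 0 * x + w * k 1 1 = w * (k 1 0 * x + k 1 1) := by ring
  have l2 : (w : ℝ) * k 0 0 * x + w * k 0 1 = w * (k 0 0 * x + k 0 1) := by ring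
  rw [l1, l2, mul_div_mul_left _ _ hw, abs_mul, abs_mul, abs_of_nonneg (by positivity :
    (0 : ℝ) ≤ |(w : ℝ)| ^ 2), Real.mul_rpow (by positivity) (abs_nonneg _),
    Real.mul_rpow (abs_nonneg _) (abs_nonneg _), hrw, mul_div_mul_left _ _ hpos.ne']

/-- `U^H_g` only depends on the class of `g` in `PGL₂(ℝ)`. -/
noncomputable def mobiusOpPGL (H : ℝ) (g : PGL(2, ℝ)) (ξ : ℝ → 𝕜) : ℝ → 𝕜 :=
  Quotient.liftOn' (s₁ := QuotientGroup.leftRel (Subgroup.center (GL (Fin 2) ℝ))) g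
    (fun h => mobiusOp H h ξ) (by
      intro g₁ g₂ h
      obtain ⟨u, rfl⟩ := Matrix.ProjGenLinGroup.mk_eq_mk_iff.mp (Quotient.sound' h :
        Matrix.ProjGenLinGroup.mk g₁ = Matrix.ProjGenLinGroup.mk g₂)
      exact (mobiusOp_mul_scalar H g₁ u ξ).symm)

theorem mobiusOpPGL_mk (H : ℝ) (g : GL (Fin 2) ℝ) (ξ : ℝ → 𝕜) :
    mobiusOpPGL H (Matrix.ProjGenLinGroup.mk g) ξ = mobiusOp H g ξ := rfl

variable (𝕜)

/-- The function `f_t^{α,γ} = U^H_{g_t⁻¹} χ_{[0,1]}`, where `g_t` sends `(α, t, γ)` to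
`(0, 1, ∞)`. -/
noncomputable def fFun (H : ℝ) (α γ t : OnePoint ℝ) : ℝ → 𝕜 :=
  mobiusOpPGL H (mobius α t γ)⁻¹ (indicator (Icc (0 : ℝ) 1) fun _ => (1 : 𝕜))

end operators

/-! ### Covariance kernels -/

/-- The covariance kernel of fractional Brownian motion. -/
noncomputable def fbmCov (H s t : ℝ) : ℝ :=
  1 / 2 * (|s| ^ (2 * H) + |t| ^ (2 * H) - |s - t| ^ (2 * H))

/-- The underlying real number of a point of `ℝ ∪ {∞}` (only used at points other than `∞`). -/
def finitePart (x : OnePoint ℝ) : ℝ := x.elim 0 id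

/-- The transported kernel `C^H_{α,β,γ}(s, t) = C^H(g(s), g(t))` for `s, t ≠ γ`, where
`g` sends `(α, β, γ)` to `(0, 1, ∞)`. -/
noncomputable def transportedCov (H : ℝ) (α β γ s t : OnePoint ℝ) : ℝ :=
  fbmCov H (finitePart (mobius α β γ • s)) (finitePart (mobius α β γ • t))

/-- The normalization of `transportedCov`, on the complement of `{α, γ}`. -/
noncomputable def normalizedCov (H : ℝ) (α β γ s t : OnePoint ℝ) : ℝ :=
  transportedCov H α β γ s t /
    √(transportedCov H α β γ s s * transportedCov H α β γ t t)

/-- A (centered) Gaussian random process indexed by the Hilbert space `E`. -/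
structure IsHilbertGaussian {𝕜 E Ω : Type*} [RCLike 𝕜] [NormedAddCommGroup E]
    [InnerProductSpace 𝕜 E] [MeasurableSpace Ω] (φ : E → Ω → 𝕜) (P : Measure Ω) : Prop where
  gaussian : ProbabilityTheory.IsGaussianProcess φ P
  mean_zero : ∀ v, ∫ ω, φ v ω ∂P = 0
  covariance : ∀ v w, ∫ ω, φ v ω * conj (φ w ω) ∂P = inner 𝕜 v w

end FracBM

/-! Write `K_x` for the signed indicator function of the interval between `0` and `x`. Its
mollifications form a Cauchy sequence in `𝓗_H`, and the limits `stepVec` have scalar products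
`C^H(x, y)` (`stepVec_isFBMCurve`). A Möbius transformation sending `γ` to `∞` is a fixed chart
followed by an affine map. Hence, if `p` and `q` are the chart coordinates of `α` and `t`, the
function `f_t` is almost everywhere `±|q - p| ^ (-H)` times either the step from `p` to `q` (for `γ
= ∞`) or the oriented function `|z - γ| ^ (-2H)` on the set where `(z - γ)⁻¹` lies between `p` and
`q`. In both cases it is a normalized increment of a curve. Once this curve has covariance `C^H`,
stationarity of increments gives norms and scalar products, and self-similarity removes `β` from the
normalized kernel.

The curve for finite `γ` is the crux. The time inversion `Z(u) = |u| ^ (2H) (K_{γ+1/u} - K_γ)` has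
covariance `C^H`, but it does not represent the inverted steps. The right curve is `2H L Z - Z` with
`L Z(u) = ∫_0^1 Z(r u) dr/r`. Formally `L` inverts the generator `A` of the dilations. Dilations
multiply scalar products by `s ^ (2H)`, so `S = A - H` is skew and `2H A⁻¹ - 1 = (H - S)/(H + S)` is
a Cayley transform, hence isometric (`cayley_isFBMCurve`).

To see that this vector is the given function, both are tested against `K_x - K_γ`. The substitution
`z = γ + 1/a` turns the integral into one over `invKernel`, and the fundamental theorem of calculus
matches it with the Cayley transform (`integral_invKernel`). Schwartz test functions follow from `η
= -∫ η'(x) K_x dx` and Fubini. The base point may be subtracted because `∫ η' = 0`; it is needed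
because an inverted step may decay only like `|z| ^ (-2H)`, so that its product with the single
kernel `|z - x| ^ (2H - 1)` is not integrable at infinity. -/

namespace FracBM

open Filter Topology

/-! ### The derivative kernel `sgn t * |t| ^ (2 H - 1)` -/

/-- The kernel `sgn t * |t| ^ (2 H - 1)`, the derivative of `|t| ^ (2 H) / (2 H)`. -/
noncomputable def signedKernel (H t : ℝ) : ℝ := Real.sign t * |t| ^ (2 * H - 1)

theorem measurable_realSign : Measurable Real.sign :=
  Measurable.ite measurableSet_Iio measurable_const
    (Measurable.ite measurableSet_Ioi measurable_const measurable_const)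

theorem measurable_signedKernel (H : ℝ) : Measurable (signedKernel H) :=
  measurable_realSign.mul (by fun_prop)

theorem abs_signedKernel_le (H t : ℝ) : |signedKernel H t| ≤ |t| ^ (2 * H - 1) := by
  have h := Real.rpow_nonneg (abs_nonneg t) (2 * H - 1)
  rw [signedKernel, abs_mul, abs_of_nonneg h]
  refine mul_le_of_le_one_left h ?_
  rcases Real.sign_apply_eq t with h | h | h <;> simp [h]

theorem signedKernel_mul_self {H t : ℝ} (ht : t ≠ 0) : signedKernel H t * t = |t| ^ (2 * H) := by
  have h0 : 0 < |t| := abs_pos.mpr ht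
  have hs : Real.sign t * t = |t| := by
    rcases lt_or_gt_of_ne ht with h | h
    · rw [Real.sign_of_neg h, abs_of_neg h]; ring
    · rw [Real.sign_of_pos h, abs_of_pos h]; ring
  have h1 : |t| ^ (2 * H) = |t| ^ (2 * H - 1) * |t| := by
    rw [← Real.rpow_add_one h0.ne']; congr 1; ring
  rw [h1, signedKernel, mul_right_comm, hs, mul_comm]

theorem realSign_mul (a b : ℝ) : Real.sign (a * b) = Real.sign a * Real.sign b := by
  rcases lt_trichotomy a 0 with ha | rfl | ha <;> rcases lt_trichotomy b 0 with hb | rfl | hb <;>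
    simp [Real.sign_of_neg, Real.sign_of_pos, *, mul_pos_of_neg_of_neg, mul_neg_of_neg_of_pos,
      mul_neg_of_pos_of_neg]

/-- Multiplicativity allows the factor `a⁻¹` to be split off the kernel under the substitution `z =
γ + a⁻¹`. -/
theorem signedKernel_mul (H a b : ℝ) :
    signedKernel H (a * b) = signedKernel H a * signedKernel H b := by
  rw [signedKernel, signedKernel, signedKernel, realSign_mul, abs_mul,
    Real.mul_rpow (abs_nonneg _) (abs_nonneg _)]
  ring

theorem hasDerivAt_abs_rpow {H t : ℝ} (ht : t ≠ 0) :
    HasDerivAt (fun t : ℝ => |t| ^ (2 * H)) (2 * H * signedKernel H t) t := by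
  have h := (hasDerivAt_abs ht).rpow_const (p := 2 * H) (Or.inl (abs_pos.mpr ht).ne')
  convert h using 1
  rw [signedKernel]
  rcases lt_or_gt_of_ne ht with h | h
  · simp [Real.sign_of_neg h, h]
  · simp [Real.sign_of_pos h, h]

theorem continuous_abs_rpow {H : ℝ} (h0 : 0 < H) : Continuous fun t : ℝ => |t| ^ (2 * H) :=
  continuous_abs.rpow_const fun _ => Or.inr (by linarith)

theorem intervalIntegrable_abs_rpow {r : ℝ} (hr : -1 < r) (a b : ℝ) :
    IntervalIntegrable (fun t : ℝ => |t| ^ r) volume a b := by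
  refine intervalIntegrable_of_even (fun x => by rw [abs_neg]) fun x hx => ?_
  refine (intervalIntegral.intervalIntegrable_rpow' hr).congr fun t ht => ?_
  rw [uIoc_of_le hx.le] at ht
  simp only [abs_of_pos ht.1]

theorem intervalIntegrable_signedKernel {H : ℝ} (h0 : 0 < H) (a b : ℝ) :
    IntervalIntegrable (signedKernel H) volume a b :=
  (intervalIntegrable_abs_rpow (r := 2 * H - 1) (by linarith) a b).mono_fun
    (measurable_signedKernel H).aestronglyMeasurable (Eventually.of_forall fun t => by
      simpa [abs_of_nonneg (Real.rpow_nonneg (abs_nonneg t) _)] using abs_signedKernel_le H t)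

theorem integral_abs_rpow_symm {H R : ℝ} (h0 : 0 < H) (hR : 0 ≤ R) :
    ∫ t in -R..R, |t| ^ (2 * H - 1) = R ^ (2 * H) / H := by
  have hi := intervalIntegrable_abs_rpow (r := 2 * H - 1) (by linarith)
  have h1 : ∫ t in (0 : ℝ)..R, |t| ^ (2 * H - 1) = R ^ (2 * H) / (2 * H) := by
    rw [intervalIntegral.integral_congr (g := fun t : ℝ => t ^ (2 * H - 1)),
      integral_rpow (Or.inl (by linarith))]
    · rw [sub_add_cancel, Real.zero_rpow (by linarith), sub_zero]
    · intro t ht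
      rw [uIcc_of_le hR] at ht
      simp only [abs_of_nonneg ht.1]
  have h2 : ∫ t in -R..0, |t| ^ (2 * H - 1) = R ^ (2 * H) / (2 * H) := by
    rw [← h1]
    simpa using intervalIntegral.integral_comp_neg (a := -R) (b := 0)
      fun t : ℝ => |t| ^ (2 * H - 1)
  rw [← intervalIntegral.integral_add_adjacent_intervals (hi (-R) 0) (hi 0 R), h1, h2]
  field_simp
  ring

/-- Enlarging the interval to `[-R, R]` gives a bound depending only on the size of the endpoints.
For endpoints linear in `x` this means growth of order `|x| ^ (2H)`. -/
theorem setIntegral_abs_rpow_le {H R : ℝ} (h0 : 0 < H) {a b : ℝ} (ha : |a| ≤ R) (hb : |b| ≤ R) :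
    ∫ t in uIoc a b, |t| ^ (2 * H - 1) ≤ R ^ (2 * H) / H := by
  have hR : 0 ≤ R := (abs_nonneg a).trans ha
  rw [← integral_abs_rpow_symm h0 hR, intervalIntegral.integral_of_le (by linarith)]
  refine setIntegral_mono_set ?_ ?_ ?_
  · have := intervalIntegrable_abs_rpow (r := 2 * H - 1) (by linarith) (-R) R
    rwa [intervalIntegrable_iff_integrableOn_Ioc_of_le (by linarith)] at this
  · exact Eventually.of_forall fun t => Real.rpow_nonneg (abs_nonneg _) _
  · refine LE.le.eventuallyLE ?_
    have ha' := abs_le.mp ha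
    have hb' := abs_le.mp hb
    exact Ioc_subset_Ioc (le_min ha'.1 hb'.1) (max_le ha'.2 hb'.2)

theorem integral_signedKernel_sub {H : ℝ} (h0 : 0 < H) (x a b : ℝ) :
    ∫ z in a..b, signedKernel H (z - x)
      = (|b - x| ^ (2 * H) - |a - x| ^ (2 * H)) / (2 * H) := by
  -- For `H ≤ 1/2` the primitive is not differentiable at `0`; its continuity there suffices, the
  -- exceptional set being countable.
  have h := integral_eq_of_hasDerivAt_off_countable (a := a - x) (b := b - x)
    (fun t : ℝ => |t| ^ (2 * H)) (fun t => 2 * H * signedKernel H t) (countable_singleton 0)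
    (continuous_abs_rpow h0).continuousOn (fun t ht => hasDerivAt_abs_rpow ht.2)
    ((intervalIntegrable_signedKernel h0 _ _).const_mul _)
  rw [intervalIntegral.integral_const_mul] at h
  rw [intervalIntegral.integral_comp_sub_right (fun t => signedKernel H t) x, ← h]
  field_simp

theorem intervalIntegrable_signedKernel_sub {H : ℝ} (h0 : 0 < H) (x a b : ℝ) :
    IntervalIntegrable (fun z => signedKernel H (z - x)) volume a b := by
  simpa using (intervalIntegrable_signedKernel h0 (a - x) (b - x)).comp_sub_right x

/-! ### The covariance kernel of fractional Brownian motion -/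

theorem fbmCov_comm (H s t : ℝ) : fbmCov H s t = fbmCov H t s := by
  rw [fbmCov, fbmCov, abs_sub_comm]; ring

theorem fbmCov_self {H : ℝ} (h0 : 0 < H) (s : ℝ) : fbmCov H s s = |s| ^ (2 * H) := by
  rw [fbmCov, sub_self, abs_zero, Real.zero_rpow (by linarith)]; ring

theorem fbmCov_zero_left {H : ℝ} (h0 : 0 < H) (s : ℝ) : fbmCov H 0 s = 0 := by
  rw [fbmCov, zero_sub, abs_neg, abs_zero, Real.zero_rpow (by linarith)]; ring

theorem fbmCov_mul (H c s t : ℝ) : fbmCov H (c * s) (c * t) = |c| ^ (2 * H) * fbmCov H s t := by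
  have h : ∀ a : ℝ, |c * a| ^ (2 * H) = |c| ^ (2 * H) * |a| ^ (2 * H) := fun a => by
    rw [abs_mul, Real.mul_rpow (abs_nonneg _) (abs_nonneg _)]
  rw [fbmCov, fbmCov, ← mul_sub, h, h, h]; ring

/-- Stationarity of increments: only the translation-invariant quantities `|x - y| ^ (2H)` survive
on the right. -/
theorem fbmCov_sub_sub {H : ℝ} (h0 : 0 < H) (p s t : ℝ) :
    fbmCov H (s - p) (t - p)
      = fbmCov H s t - fbmCov H s p - fbmCov H p t + fbmCov H p p := by
  simp only [fbmCov, sub_sub_sub_cancel_right, sub_self, abs_zero,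
    Real.zero_rpow (by linarith : 2 * H ≠ 0)]
  rw [abs_sub_comm p t]
  ring

/-- Time inversion rests on `|s| |t| |s⁻¹ - t⁻¹| = |s - t|`. At `s = 0` or `t = 0`, where `0⁻¹ = 0`,
both sides vanish. -/
theorem fbmCov_inv {H : ℝ} (h0 : 0 < H) (s t : ℝ) :
    |s| ^ (2 * H) * |t| ^ (2 * H) * fbmCov H s⁻¹ t⁻¹ = fbmCov H s t := by
  have hz : |(0 : ℝ)| ^ (2 * H) = 0 := by rw [abs_zero, Real.zero_rpow (by linarith)]
  rcases eq_or_ne s 0 with rfl | hs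
  · rw [hz, fbmCov_zero_left h0]; ring
  rcases eq_or_ne t 0 with rfl | ht
  · rw [hz, fbmCov_comm H s, fbmCov_zero_left h0]; ring
  have h : ∀ a b : ℝ, |a * b| ^ (2 * H) = |a| ^ (2 * H) * |b| ^ (2 * H) := fun a b => by
    rw [abs_mul, Real.mul_rpow (abs_nonneg _) (abs_nonneg _)]
  have e1 : s * s⁻¹ = 1 := mul_inv_cancel₀ hs
  have e2 : t * t⁻¹ = 1 := mul_inv_cancel₀ ht
  have f1 : |s| ^ (2 * H) * |s⁻¹| ^ (2 * H) = 1 := by rw [← h, e1]; simp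
  have f2 : |t| ^ (2 * H) * |t⁻¹| ^ (2 * H) = 1 := by rw [← h, e2]; simp
  have f3 : |s| ^ (2 * H) * |t| ^ (2 * H) * |s⁻¹ - t⁻¹| ^ (2 * H) = |s - t| ^ (2 * H) := by
    rw [← h, ← h, abs_sub_comm s t]
    congr 2
    field_simp
  rw [fbmCov, fbmCov]
  linear_combination (1 / 2 * |t| ^ (2 * H)) * f1 + (1 / 2 * |s| ^ (2 * H)) * f2 - 1 / 2 * f3

theorem continuous_fbmCov {H : ℝ} (h0 : 0 < H) :
    Continuous fun p : ℝ × ℝ => fbmCov H p.1 p.2 := by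
  have hc := continuous_abs_rpow h0
  unfold fbmCov
  exact continuous_const.mul (((hc.comp continuous_fst).add (hc.comp continuous_snd)).sub
    (hc.comp (continuous_fst.sub continuous_snd)))

/-! ### Curves with the covariance of fractional Brownian motion -/

section curves
variable {𝕜 E : Type*} [RCLike 𝕜] [NormedAddCommGroup E] [InnerProductSpace 𝕜 E]

variable (𝕜) in
/-- The scalar products of the points of `Z` are given by the covariance kernel of fractional
Brownian motion. -/
def IsFBMCurve (H : ℝ) (Z : ℝ → E) : Prop :=
  ∀ u v, inner 𝕜 (Z u) (Z v) = ((fbmCov H u v : ℝ) : 𝕜)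

namespace IsFBMCurve
variable {H : ℝ} {Z : ℝ → E}

theorem norm_sq (hZ : IsFBMCurve 𝕜 H Z) (h0 : 0 < H) (u : ℝ) : ‖Z u‖ ^ 2 = |u| ^ (2 * H) := by
  have h := hZ u u
  rw [inner_self_eq_norm_sq_to_K, fbmCov_self h0] at h
  exact_mod_cast h

theorem norm_eq (hZ : IsFBMCurve 𝕜 H Z) (h0 : 0 < H) (u : ℝ) : ‖Z u‖ = |u| ^ H := by
  have h := hZ.norm_sq h0 u
  rw [mul_comm, Real.rpow_mul (abs_nonneg _), Real.rpow_ofNat] at h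
  exact (pow_left_inj₀ (norm_nonneg _) (Real.rpow_nonneg (abs_nonneg _) _) two_ne_zero).mp h

theorem sub_const (hZ : IsFBMCurve 𝕜 H Z) (h0 : 0 < H) (p : ℝ) :
    IsFBMCurve 𝕜 H fun u => Z (p + u) - Z p := by
  intro u v
  simp only [inner_sub_left, inner_sub_right, hZ _ _]
  have := fbmCov_sub_sub h0 p (p + u) (p + v)
  rw [add_sub_cancel_left, add_sub_cancel_left] at this
  rw [this]
  push_cast
  ring

/-- Stationarity of increments gives `‖Z u - Z p‖ = |u - p| ^ H`, so the curve is Hölder continuous.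
-/
theorem continuous (hZ : IsFBMCurve 𝕜 H Z) (h0 : 0 < H) : Continuous Z := by
  rw [continuous_iff_continuousAt]
  intro p
  rw [ContinuousAt, tendsto_iff_norm_sub_tendsto_zero]
  have h : ∀ u, ‖Z u - Z p‖ = |u - p| ^ H := fun u => by
    simpa using (hZ.sub_const h0 p).norm_eq h0 (u - p)
  simp only [h]
  have : Continuous fun u : ℝ => |u - p| ^ H :=
    (by fun_prop : Continuous fun u : ℝ => |u - p|).rpow_const fun _ => Or.inr h0.le
  simpa [Real.zero_rpow h0.ne'] using this.tendsto p

theorem inversion (hZ : IsFBMCurve 𝕜 H Z) (h0 : 0 < H) :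
    IsFBMCurve 𝕜 H fun u => ((|u| ^ (2 * H) : ℝ) : 𝕜) • Z u⁻¹ := by
  intro u v
  rw [inner_smul_left, inner_smul_right, hZ, RCLike.conj_ofReal, ← fbmCov_inv h0 u v]
  push_cast
  ring

/-! ### Dilations, the logarithmic mean and the Cayley transform -/

variable [NormedSpace ℝ E]

/-- The average `∫ r in (0, 1), r⁻¹ • Z (r u)`. -/
noncomputable def logMean (Z : ℝ → E) (u : ℝ) : E := ∫ r in Ioc (0 : ℝ) 1, r⁻¹ • Z (r * u)

/-- The integrand has norm `|u| ^ H * r ^ (H - 1)`, which is integrable at `0` since `H > 0`. -/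
theorem intervalIntegrable_inv_smul (hZ : IsFBMCurve 𝕜 H Z) (h0 : 0 < H) (u b : ℝ) (hb : 0 ≤ b) :
    IntervalIntegrable (fun r : ℝ => r⁻¹ • Z (r * u)) volume 0 b := by
  have hi := (intervalIntegral.intervalIntegrable_rpow' (a := 0) (b := b) (r := H - 1)
    (by linarith)).const_mul (|u| ^ H)
  refine hi.mono_fun ?_ ?_
  · have : ContinuousOn (fun r : ℝ => r⁻¹ • Z (r * u)) (uIoc 0 b) := by
      refine ContinuousOn.smul (continuousOn_inv₀.mono fun r hr => ?_)
        ((hZ.continuous h0).comp (continuous_mul_const u)).continuousOn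
      rw [uIoc_of_le hb] at hr
      exact hr.1.ne'
    exact this.aestronglyMeasurable measurableSet_uIoc
  · rw [uIoc_of_le hb]
    filter_upwards [ae_restrict_mem measurableSet_Ioc] with r hr
    rw [norm_smul, hZ.norm_eq h0, abs_mul, Real.mul_rpow (abs_nonneg _) (abs_nonneg _), norm_inv,
      Real.norm_of_nonneg hr.1.le, abs_of_pos hr.1, Real.norm_of_nonneg
        (mul_nonneg (Real.rpow_nonneg (abs_nonneg _) _) (Real.rpow_nonneg hr.1.le _)),
      Real.rpow_sub_one hr.1.ne']
    exact le_of_eq (by ring)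

theorem integrableOn_inv_smul (hZ : IsFBMCurve 𝕜 H Z) (h0 : 0 < H) (u : ℝ) :
    IntegrableOn (fun r : ℝ => r⁻¹ • Z (r * u)) (Ioc 0 1) :=
  (intervalIntegrable_iff_integrableOn_Ioc_of_le zero_le_one).mp
    (hZ.intervalIntegrable_inv_smul h0 u 1 zero_le_one)

/-- The measure `dr / r` is invariant under dilation, so `s` moves into the upper limit, where the
fundamental theorem of calculus can differentiate it. -/
theorem logMean_mul {s : ℝ} (hs : 0 < s) (u : ℝ) :
    logMean Z (s * u) = ∫ r in (0 : ℝ)..s, r⁻¹ • Z (r * u) := by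
  rw [logMean, ← intervalIntegral.integral_of_le zero_le_one]
  have h := intervalIntegral.smul_integral_comp_mul_left (a := 0) (b := 1)
    (fun r : ℝ => r⁻¹ • Z (r * u)) s
  rw [mul_zero, mul_one] at h
  rw [← h, ← intervalIntegral.integral_smul]
  refine intervalIntegral.integral_congr fun r _ => ?_
  simp only [smul_smul]
  congr 2
  · field_simp
  · ring

variable [CompleteSpace E]

/-- In this sense `logMean` inverts the generator of the dilations. -/
theorem hasDerivAt_logMean_mul (hZ : IsFBMCurve 𝕜 H Z) (h0 : 0 < H) (u : ℝ) :
    HasDerivAt (fun s => logMean Z (s * u)) (Z u) 1 := by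
  have hc : ContinuousOn (fun r : ℝ => r⁻¹ • Z (r * u)) (Ioi 0) :=
    ContinuousOn.smul (continuousOn_inv₀.mono fun r hr => (ne_of_gt hr))
        ((hZ.continuous h0).comp (continuous_mul_const u)).continuousOn
  have h := intervalIntegral.integral_hasDerivAt_right
    (hZ.intervalIntegrable_inv_smul h0 u 1 zero_le_one)
    (hc.stronglyMeasurableAtFilter isOpen_Ioi 1 (mem_Ioi.mpr one_pos))
    (hc.continuousAt (Ioi_mem_nhds one_pos))
  rw [inv_one, one_smul, one_mul] at h
  refine h.congr_of_eventuallyEq ?_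
  filter_upwards [Ioi_mem_nhds one_pos] with s hs using logMean_mul hs u

variable [IsScalarTower ℝ 𝕜 E]

theorem inner_logMean_right (hZ : IsFBMCurve 𝕜 H Z) (h0 : 0 < H) (u : ℝ) (w : E) :
    inner 𝕜 w (logMean Z u) = ∫ r in Ioc (0 : ℝ) 1, ((r⁻¹ : ℝ) : 𝕜) * inner 𝕜 w (Z (r * u)) := by
  rw [logMean, ← integral_inner (hZ.integrableOn_inv_smul h0 u) w]
  simp only [RCLike.real_smul_eq_coe_smul (K := 𝕜), inner_smul_right]

theorem inner_logMean_right_real (hZ : IsFBMCurve 𝕜 H Z) (h0 : 0 < H) (u v : ℝ) :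
    inner 𝕜 (Z u) (logMean Z v)
      = ((∫ r in Ioc (0 : ℝ) 1, r⁻¹ * fbmCov H u (r * v) : ℝ) : 𝕜) := by
  rw [hZ.inner_logMean_right h0, ← integral_ofReal]
  simp only [hZ _ _, RCLike.ofReal_mul]

theorem inner_logMean_logMean (hZ : IsFBMCurve 𝕜 H Z) (h0 : 0 < H) (u v : ℝ) :
    inner 𝕜 (logMean Z u) (logMean Z v)
      = ((∫ r in Ioc (0 : ℝ) 1, r⁻¹ * ∫ t in Ioc (0 : ℝ) 1, t⁻¹ * fbmCov H (r * v) (t * u) : ℝ) :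
        𝕜) := by
  rw [hZ.inner_logMean_right h0, ← integral_ofReal]
  refine integral_congr_ae (Eventually.of_forall fun r => ?_)
  simp only
  rw [← inner_conj_symm, hZ.inner_logMean_right_real h0, RCLike.conj_ofReal, RCLike.ofReal_mul]

theorem inner_logMean_mul (hZ : IsFBMCurve 𝕜 H Z) (h0 : 0 < H) {s : ℝ} (hs : 0 < s) (u v : ℝ) :
    inner 𝕜 (logMean Z (s * u)) (logMean Z (s * v))
      = ((s ^ (2 * H) : ℝ) : 𝕜) * inner 𝕜 (logMean Z u) (logMean Z v) := by
  have h : ∀ r t : ℝ, t⁻¹ * fbmCov H (r * (s * v)) (t * (s * u))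
      = s ^ (2 * H) * (t⁻¹ * fbmCov H (r * v) (t * u)) := fun r t => by
    rw [mul_left_comm r, mul_left_comm t, fbmCov_mul, abs_of_pos hs]; ring
  rw [hZ.inner_logMean_logMean h0, hZ.inner_logMean_logMean h0, ← RCLike.ofReal_mul]
  simp only [h, integral_const_mul]
  rw [← integral_const_mul]
  simp only [mul_left_comm]

/-- Differentiate `⟨L(su), L(sv)⟩ = s ^ (2H) ⟨L(u), L(v)⟩`, where `L = logMean Z`, at `s = 1`. The
product rule yields one side and the power of `s` the other: the generator minus `H` is skew. -/
theorem inner_add_inner_logMean (hZ : IsFBMCurve 𝕜 H Z) (h0 : 0 < H) (u v : ℝ) :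
    inner 𝕜 (logMean Z u) (Z v) + inner 𝕜 (Z u) (logMean Z v)
      = 2 * (H : 𝕜) * inner 𝕜 (logMean Z u) (logMean Z v) := by
  have h1 := (hZ.hasDerivAt_logMean_mul h0 u).inner 𝕜 (hZ.hasDerivAt_logMean_mul h0 v)
  have h2 := ((Real.hasDerivAt_rpow_const (x := 1) (p := 2 * H) (Or.inl one_ne_zero)).smul_const
    (inner 𝕜 (logMean Z u) (logMean Z v)))
  have h3 := h1.unique (h2.congr_of_eventuallyEq (by
    filter_upwards [Ioi_mem_nhds one_pos] with s hs
    rw [hZ.inner_logMean_mul h0 hs, RCLike.real_smul_eq_coe_mul]))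
  rw [one_mul, one_mul, Real.one_rpow, mul_one, RCLike.real_smul_eq_coe_mul] at h3
  rw [h3]
  push_cast
  ring

/-- The curve `2 H • logMean Z - Z`: the image of `Z` under the Cayley transform of the generator
of the dilation group. -/
noncomputable def cayley (H : ℝ) (Z : ℝ → E) (u : ℝ) : E := (2 * H) • logMean Z u - Z u

/-- On expanding, the quadratic term `4H² ⟨L(u), L(v)⟩` cancels against the cross terms by
`inner_add_inner_logMean`, and `⟨Z(u), Z(v)⟩` remains. -/
theorem cayley_isFBMCurve (hZ : IsFBMCurve 𝕜 H Z) (h0 : 0 < H) :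
    IsFBMCurve 𝕜 H (cayley H Z) := by
  intro u v
  have h := hZ.inner_add_inner_logMean h0 u v
  simp only [cayley, RCLike.real_smul_eq_coe_smul (K := 𝕜), inner_sub_left, inner_sub_right,
    inner_smul_left, inner_smul_right, RCLike.conj_ofReal, hZ u v]
  push_cast
  linear_combination (-2 * (H : 𝕜)) * h

end IsFBMCurve
end curves
end FracBM

namespace FracBM

open Filter Topology

/-! ### The curve of indicator functions in `𝓗_H` -/

/-- A sequence of smooth bumps shrinking to `0`. -/
noncomputable def shrinkingBump (n : ℕ) : ContDiffBump (0 : ℝ) where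
  rIn := 1 / (n + 1) / 2
  rOut := 1 / (n + 1)
  rIn_pos := by positivity
  rIn_lt_rOut := half_lt_self (by positivity)

/-- The bump `shrinkingBump n`, normalized to have integral `1`. -/
noncomputable def mollifier (n : ℕ) (x : ℝ) : ℝ := (shrinkingBump n).normed volume x

/-- Convolution with `mollifier n`. -/
noncomputable def mollify (n : ℕ) (g : ℝ → ℝ) (s : ℝ) : ℝ := ∫ b, mollifier n b * g (s - b)

theorem mollify_eq (n : ℕ) (g : ℝ → ℝ) : mollify n g =
    MeasureTheory.convolution ((shrinkingBump n).normed volume) g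
      (ContinuousLinearMap.lsmul ℝ ℝ) volume := rfl

theorem tendsto_rOut_shrinkingBump : Tendsto (fun n => (shrinkingBump n).rOut) atTop (𝓝 0) :=
  tendsto_one_div_add_atTop_nhds_zero_nat

theorem continuous_mollifier (n : ℕ) : Continuous (mollifier n) :=
  (shrinkingBump n).continuous_normed

theorem mollifier_nonneg (n : ℕ) (x : ℝ) : 0 ≤ mollifier n x := (shrinkingBump n).nonneg_normed x

theorem mollifier_neg (n : ℕ) (x : ℝ) : mollifier n (-x) = mollifier n x :=
  (shrinkingBump n).normed_neg x

theorem integral_mollifier (n : ℕ) : ∫ x, mollifier n x = 1 := (shrinkingBump n).integral_normed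

theorem hasCompactSupport_mollifier (n : ℕ) : HasCompactSupport (mollifier n) :=
  (shrinkingBump n).hasCompactSupport_normed

theorem mollifier_eq_zero {n : ℕ} {x : ℝ} (hx : 1 ≤ |x|) : mollifier n x = 0 := by
  have h := (shrinkingBump n).support_normed_eq (μ := volume)
  by_contra hne
  have hm : x ∈ Function.support ((shrinkingBump n).normed volume) := hne
  rw [h, Metric.mem_ball, dist_zero_right, Real.norm_eq_abs] at hm
  have : (shrinkingBump n).rOut ≤ 1 := by
    simp only [shrinkingBump]
    rw [div_le_one (by positivity)]
    linarith [(Nat.cast_nonneg n : (0 : ℝ) ≤ n)]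
  linarith

theorem integrable_mollifier_mul (n : ℕ) {g : ℝ → ℝ} (hg : Continuous g) :
    Integrable fun b => mollifier n b * g b :=
  ((continuous_mollifier n).mul hg).integrable_of_hasCompactSupport
    (hasCompactSupport_mollifier n).mul_right

theorem continuous_mollify (n : ℕ) {g : ℝ → ℝ} (hg : Continuous g) : Continuous (mollify n g) := by
  rw [mollify_eq]
  exact (hasCompactSupport_mollifier n).continuous_convolution_left _
    (continuous_mollifier n) hg.locallyIntegrable

/-- The evaluation point may move together with `n`; this uniformity is what an outer mollification
requires of the inner one. -/
theorem tendsto_mollify_uncurry {g : ℝ → ℝ} (hg : Continuous g) (s : ℝ) :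
    Tendsto (fun p : ℕ × ℝ => mollify p.1 g p.2) (atTop ×ˢ 𝓝 s) (𝓝 (g s)) := by
  have h := ContDiffBump.convolution_tendsto_right (μ := volume) (l := atTop ×ˢ 𝓝 s)
    (φ := fun p : ℕ × ℝ => shrinkingBump p.1) (g := fun _ => g) (k := Prod.snd) (x₀ := s)
    (z₀ := g s) (tendsto_rOut_shrinkingBump.comp tendsto_fst)
    (Eventually.of_forall fun _ => hg.aestronglyMeasurable)
    ((hg.tendsto s).comp tendsto_snd) tendsto_snd
  simpa only [mollify_eq] using h

theorem tendsto_mollify {g : ℝ → ℝ} (hg : Continuous g) (s : ℝ) :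
    Tendsto (fun n => mollify n g s) atTop (𝓝 (g s)) := by
  have h : Tendsto (fun n : ℕ => (n, s)) atTop (atTop ×ˢ 𝓝 s) :=
    tendsto_id.prodMk tendsto_const_nhds
  have h' := (tendsto_mollify_uncurry hg s).comp h
  exact h'

theorem tendsto_mollify_mollify {g : ℝ → ℝ} (hg : Continuous g) (s : ℝ) :
    Tendsto (fun p : ℕ × ℕ => mollify p.1 (mollify p.2 g) s) atTop (𝓝 (g s)) := by
  rw [← prod_atTop_atTop_eq]
  have hp : Tendsto (fun q : (ℕ × ℕ) × ℝ => (q.1.2, q.2))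
      (((atTop : Filter ℕ) ×ˢ (atTop : Filter ℕ)) ×ˢ 𝓝 s) (atTop ×ˢ 𝓝 s) :=
    (tendsto_snd.comp tendsto_fst).prodMk tendsto_snd
  have hu := (tendsto_mollify_uncurry hg s).comp hp
  have h := ContDiffBump.convolution_tendsto_right (μ := volume)
    (l := (atTop : Filter ℕ) ×ˢ (atTop : Filter ℕ))
    (φ := fun p : ℕ × ℕ => shrinkingBump p.1) (g := fun p => mollify p.2 g) (k := fun _ => s)
    (x₀ := s) (z₀ := g s) (tendsto_rOut_shrinkingBump.comp tendsto_fst)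
    (Eventually.of_forall fun p => (continuous_mollify p.2 hg).aestronglyMeasurable)
    hu tendsto_const_nhds
  exact h.congr fun p => by rw [mollify_eq p.1]

/-- All mollifiers live in `|b| < 1`, where `(1 + |b|) ^ 2 ≤ 4`. The bound is uniform in `n` and
provides the majorant for dominated convergence. -/
theorem abs_mollify_abs_rpow_le {H : ℝ} (h0 : 0 < H) (h1 : H < 1) (n : ℕ) (s : ℝ) :
    |mollify n (fun t => |t| ^ (2 * H)) s| ≤ 4 * (1 + |s|) ^ 2 := by
  have hle : ∀ b, ‖mollifier n b * |s - b| ^ (2 * H)‖ ≤ mollifier n b * (4 * (1 + |s|) ^ 2) := by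
    intro b
    have hm := mollifier_nonneg n b
    rw [Real.norm_of_nonneg (mul_nonneg hm (Real.rpow_nonneg (abs_nonneg _) _))]
    rcases le_or_gt 1 |b| with hb | hb
    · rw [mollifier_eq_zero hb]; simp
    · refine mul_le_mul_of_nonneg_left ((abs_sub_rpow_le h0 h1 s b).trans ?_) hm
      have hb2 : (1 + |b|) ^ 2 ≤ 4 := by nlinarith [abs_nonneg b]
      nlinarith [mul_le_mul_of_nonneg_left hb2 (sq_nonneg (1 + |s|))]
  refine (norm_integral_le_of_norm_le
    ((shrinkingBump n).integrable_normed.mul_const _) (Eventually.of_forall hle)).trans ?_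
  rw [integral_mul_const]
  change (∫ x, mollifier n x) * _ ≤ _
  rw [integral_mollifier, one_mul]

/-! ### Mollified steps and their limit -/

section curve
variable {𝕜 : Type*} [RCLike 𝕜]

theorem hasDerivAt_integral_mollifier (n : ℕ) (x y : ℝ) :
    HasDerivAt (fun y => ∫ t in (y - x)..y, mollifier n t)
      (mollifier n y - mollifier n (y - x)) y := by
  have hc := continuous_mollifier n
  have hp : ∀ y, HasDerivAt (fun y => ∫ t in (0 : ℝ)..y, mollifier n t) (mollifier n y) y :=
    fun y => hc.integral_hasStrictDerivAt 0 y |>.hasDerivAt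
  refine ((hp y).sub ((hp (y - x)).comp_sub_const y x)).congr_of_eventuallyEq
    (Eventually.of_forall fun z => ?_)
  exact (intervalIntegral.integral_interval_sub_left (hc.intervalIntegrable _ _)
    (hc.intervalIntegrable _ _)).symm

variable (𝕜) in
/-- The mollification of the signed indicator function of the interval between `0` and `x`. -/
noncomputable def mollStep (n : ℕ) (x : ℝ) : 𝓢(ℝ, 𝕜) :=
  HasCompactSupport.toSchwartzMap
    (f := fun y => ((∫ t in (y - x)..y, mollifier n t : ℝ) : 𝕜))
    (by
      -- For `|y| > |x| + 1` the whole interval between `y - x` and `y` avoids `(-1, 1)`, where the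
      -- mollifier lives.
      refine HasCompactSupport.intro (isCompact_Icc (a := -(|x| + 1)) (b := |x| + 1))
        fun y hy => ?_
      rw [intervalIntegral.integral_congr (g := fun _ => 0), intervalIntegral.integral_zero,
        RCLike.ofReal_zero]
      intro t ht
      refine mollifier_eq_zero ?_
      have hx := neg_abs_le x
      have hx' := le_abs_self x
      rw [mem_Icc, not_and_or, not_le, not_le] at hy
      rw [mem_uIcc] at ht
      rw [le_abs]
      rcases hy with hy | hy
      · right; rcases ht with ht | ht <;> linarith [ht.1, ht.2]
      · left; rcases ht with ht | ht <;> linarith [ht.1, ht.2])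
    (by
      refine (RCLike.ofRealCLM (K := 𝕜)).contDiff.comp ?_
      rw [contDiff_infty_iff_deriv]
      refine ⟨fun y => (hasDerivAt_integral_mollifier n x y).differentiableAt, ?_⟩
      rw [funext fun y => (hasDerivAt_integral_mollifier n x y).deriv]
      have hs : ContDiff ℝ (⊤ : ℕ∞) (mollifier n) := (shrinkingBump n).contDiff_normed
      exact hs.sub (hs.comp (contDiff_id.sub contDiff_const)))

theorem deriv_mollStep (n : ℕ) (x y : ℝ) :
    deriv (mollStep 𝕜 n x) y = ((mollifier n y - mollifier n (y - x) : ℝ) : 𝕜) :=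
  ((RCLike.ofRealCLM (K := 𝕜)).hasFDerivAt.comp_hasDerivAt y
    (hasDerivAt_integral_mollifier n x y)).deriv

/-- The derivative of the mollified step is a difference of approximate point masses at `0` and `x`,
so the inner integral is a difference of mollified values of `|t| ^ (2H)`. -/
theorem hForm_mollStep {H : ℝ} (h0 : 0 < H) (η : 𝓢(ℝ, 𝕜)) (n : ℕ) (x : ℝ) :
    hForm H η (mollStep 𝕜 n x) = -(1 / 2) * ∫ a, conj (deriv η a) *
      ((mollify n (fun t => |t| ^ (2 * H)) a - mollify n (fun t => |t| ^ (2 * H)) (a - x) : ℝ) :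
        𝕜) := by
  have hc := continuous_abs_rpow h0
  rw [hForm]
  congr 2 with a
  have h : ∀ b, conj (deriv η a) * deriv (mollStep 𝕜 n x) b * ((|a - b| ^ (2 * H) : ℝ) : 𝕜)
      = conj (deriv η a) * ((mollifier n b * |a - b| ^ (2 * H)
        - mollifier n (b - x) * |a - x - (b - x)| ^ (2 * H) : ℝ) : 𝕜) := fun b => by
    rw [deriv_mollStep, sub_sub_sub_cancel_right]
    push_cast
    ring
  simp only [h]
  have hi : ∀ s, Integrable fun b => mollifier n b * |s - b| ^ (2 * H) := fun s =>
    integrable_mollifier_mul n (hc.comp (continuous_const.sub continuous_id))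
  rw [integral_const_mul, integral_ofReal, integral_sub (hi a) ((hi (a - x)).comp_sub_right x)]
  rw [integral_sub_right_eq_self (fun b => mollifier n b * |a - x - b| ^ (2 * H)) x]
  rfl

theorem hForm_mollStep_mollStep {H : ℝ} (h0 : 0 < H) (n m : ℕ) (x y : ℝ) :
    hForm H (mollStep 𝕜 n x) (mollStep 𝕜 m y) = ((
      -(1 / 2) * (mollify n (mollify m fun t => |t| ^ (2 * H)) 0
        - mollify n (mollify m fun t => |t| ^ (2 * H)) (-y)
        - mollify n (mollify m fun t => |t| ^ (2 * H)) x
        + mollify n (mollify m fun t => |t| ^ (2 * H)) (x - y)) : ℝ) : 𝕜) := by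
  set α := mollify m fun t => |t| ^ (2 * H) with hα
  have hcα : Continuous α := continuous_mollify m (continuous_abs_rpow h0)
  have hint : ∀ s, Integrable fun a => mollifier n a * α (a + s) := fun s =>
    integrable_mollifier_mul n (hcα.comp (continuous_id.add continuous_const))
  have hval : ∀ s, ∫ a, mollifier n a * α (a + s) = mollify n α s := fun s => by
    rw [mollify, ← integral_neg_eq_self]
    refine integral_congr_ae (Eventually.of_forall fun a => ?_)
    simp only [mollifier_neg]
    congr 2
    ring
  rw [hForm_mollStep h0, ← hα]
  have h : ∀ a, conj (deriv (mollStep 𝕜 n x) a) * ((α a - α (a - y) : ℝ) : 𝕜)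
      = ((mollifier n a * α (a + 0) - mollifier n a * α (a + -y)
        - (mollifier n (a - x) * α (a - x + x) - mollifier n (a - x) * α (a - x + (x - y))) : ℝ) :
          𝕜) := fun a => by
    rw [deriv_mollStep, RCLike.conj_ofReal, ← RCLike.ofReal_mul]
    congr 1
    rw [add_zero, sub_add_cancel, ← sub_eq_add_neg, sub_add_sub_cancel]
    ring
  simp only [h]
  have i1 : Integrable fun a => mollifier n a * α (a + 0) - mollifier n a * α (a + -y) :=
    (hint 0).sub (hint (-y))
  have i2 : Integrable fun a => mollifier n a * α (a + x) - mollifier n a * α (a + (x - y)) :=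
    (hint x).sub (hint (x - y))
  rw [integral_ofReal, integral_sub i1 (i2.comp_sub_right x), integral_sub (hint 0) (hint (-y)),
    integral_sub_right_eq_self
      (fun a => mollifier n a * α (a + x) - mollifier n a * α (a + (x - y))) x,
    integral_sub (hint x) (hint (x - y)), hval, hval, hval, hval]
  push_cast
  ring

/-- As the approximate point masses shrink, the form tends to `-1/2` times the second difference `0
- |y| ^ (2H) - |x| ^ (2H) + |x - y| ^ (2H)`. The convergence is joint in both indices, as the Cauchy
property demands. -/
theorem tendsto_hForm_mollStep_mollStep {H : ℝ} (h0 : 0 < H) (x y : ℝ) :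
    Tendsto (fun p : ℕ × ℕ => hForm H (mollStep 𝕜 p.1 x) (mollStep 𝕜 p.2 y)) atTop
      (𝓝 ((fbmCov H x y : ℝ) : 𝕜)) := by
  simp only [hForm_mollStep_mollStep h0]
  refine (RCLike.continuous_ofReal.tendsto _).comp ?_
  have h := tendsto_mollify_mollify (continuous_abs_rpow h0)
  have hl := ((((h 0).sub (h (-y))).sub (h x)).add (h (x - y))).const_mul (-(1 / 2))
  convert hl using 2
  rw [fbmCov, abs_neg, abs_zero, Real.zero_rpow (by linarith)]
  ring

theorem tendsto_hForm_mollStep {H : ℝ} (h0 : 0 < H) (h1 : H < 1) (η : 𝓢(ℝ, 𝕜)) (x : ℝ) :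
    Tendsto (fun n => hForm H η (mollStep 𝕜 n x)) atTop
      (𝓝 (-(1 / 2) * ∫ a, conj (deriv η a) *
        ((|a| ^ (2 * H) - |a - x| ^ (2 * H) : ℝ) : 𝕜))) := by
  simp only [hForm_mollStep h0]
  have hc := continuous_abs_rpow h0
  refine Tendsto.const_mul _ (tendsto_integral_of_dominated_convergence
    (fun a => (4 + 4 * (1 + |x|) ^ 2) * ((1 + |a|) ^ 2 * ‖deriv η a‖)) (fun n => ?_)
    ((integrable_deriv_mul η).const_mul _) (fun n => Eventually.of_forall fun a => ?_)
    (Eventually.of_forall fun a => ?_))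
  · have hm := continuous_mollify n hc
    exact ((RCLike.continuous_conj.comp (continuous_deriv η)).mul (RCLike.continuous_ofReal.comp
      (hm.sub (hm.comp (continuous_id.sub continuous_const))))).aestronglyMeasurable
  · rw [norm_mul, RCLike.norm_conj, RCLike.norm_ofReal]
    have e1 := abs_mollify_abs_rpow_le h0 h1 n a
    have e2 := abs_mollify_abs_rpow_le h0 h1 n (a - x)
    have e3 : 1 + |a - x| ≤ (1 + |x|) * (1 + |a|) := by
      have := abs_sub a x
      nlinarith [mul_nonneg (abs_nonneg x) (abs_nonneg a)]
    have e4 : (1 + |a - x|) ^ 2 ≤ ((1 + |x|) * (1 + |a|)) ^ 2 :=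
      pow_le_pow_left₀ (by positivity) e3 2
    have e5 := abs_sub (mollify n (fun t => |t| ^ (2 * H)) a)
      (mollify n (fun t => |t| ^ (2 * H)) (a - x))
    calc _ ≤ ‖deriv η a‖ * ((4 + 4 * (1 + |x|) ^ 2) * (1 + |a|) ^ 2) := by
          refine mul_le_mul_of_nonneg_left ?_ (norm_nonneg _)
          nlinarith
      _ = _ := by ring
  · exact Tendsto.const_mul _ ((RCLike.continuous_ofReal.tendsto _).comp
      ((tendsto_mollify hc a).sub (tendsto_mollify hc (a - x))))

variable {H : Ioo (0 : ℝ) 1}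

/-- The four scalar products in the squared distance of the `n`-th and `m`-th terms all tend to
`C^H(x, x)`, by the joint limit composed with the index pairs `(n, n)`, `(n, m)`, `(m, n)`, `(m,
m)`. -/
theorem cauchySeq_mollStep (x : ℝ) :
    CauchySeq fun n => toHSpace H (mollStep 𝕜 n x) := by
  rw [cauchySeq_iff_tendsto_dist_atTop_0]
  have h := tendsto_hForm_mollStep_mollStep (𝕜 := 𝕜) H.2.1 x x
  have h11 := h.comp ((tendsto_fst (f := atTop) (g := atTop)).prodMk
    (tendsto_fst (f := (atTop : Filter ℕ)) (g := (atTop : Filter ℕ))) |>.mono_right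
      (prod_atTop_atTop_eq).le)
  have h22 := h.comp ((tendsto_snd (f := atTop) (g := atTop)).prodMk
    (tendsto_snd (f := (atTop : Filter ℕ)) (g := (atTop : Filter ℕ))) |>.mono_right
      (prod_atTop_atTop_eq).le)
  have h21 := h.comp ((tendsto_snd (f := atTop) (g := atTop)).prodMk
    (tendsto_fst (f := (atTop : Filter ℕ)) (g := (atTop : Filter ℕ))) |>.mono_right
      (prod_atTop_atTop_eq).le)
  rw [prod_atTop_atTop_eq] at h11 h22 h21
  have hsum := RCLike.continuous_re.tendsto _ |>.comp (((h11.sub h).sub h21).add h22)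
  have hsq := (Real.continuous_sqrt.tendsto _).comp hsum
  have hz : √(RCLike.re (((fbmCov H x x : ℝ) : 𝕜) - ((fbmCov H x x : ℝ) : 𝕜)
      - ((fbmCov H x x : ℝ) : 𝕜) + ((fbmCov H x x : ℝ) : 𝕜))) = 0 := by simp
  rw [hz] at hsq
  refine hsq.congr fun p => ?_
  simp only [Function.comp]
  rw [dist_eq_norm, norm_eq_sqrt_re_inner (𝕜 := 𝕜), inner_sub_left, inner_sub_right,
    inner_sub_right]
  simp only [inner_toHSpace]
  congr 2
  ring

variable (𝕜 H) in
/-- The signed indicator function of the interval between `0` and `x`, as an element of `𝓗_H`. -/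
noncomputable def stepVec (x : ℝ) : HSpace 𝕜 H :=
  (cauchySeq_tendsto_of_complete (cauchySeq_mollStep (𝕜 := 𝕜) (H := H) x)).choose

theorem tendsto_mollStep (x : ℝ) :
    Tendsto (fun n => toHSpace H (mollStep 𝕜 n x)) atTop (𝓝 (stepVec 𝕜 H x)) :=
  (cauchySeq_tendsto_of_complete (cauchySeq_mollStep (𝕜 := 𝕜) (H := H) x)).choose_spec

theorem stepVec_isFBMCurve : IsFBMCurve 𝕜 H (stepVec 𝕜 H) := by
  intro x y
  refine tendsto_nhds_unique ((tendsto_mollStep x).inner (tendsto_mollStep y)) ?_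
  simp only [inner_toHSpace]
  have hd : Tendsto (fun n : ℕ => (n, n)) atTop (atTop : Filter (ℕ × ℕ)) := by
    rw [← prod_atTop_atTop_eq]
    exact tendsto_id.prodMk tendsto_id
  have h := (tendsto_hForm_mollStep_mollStep (𝕜 := 𝕜) H.2.1 x y).comp hd
  exact h

theorem inner_stepVec (η : 𝓢(ℝ, 𝕜)) (x : ℝ) :
    inner 𝕜 (toHSpace H η) (stepVec 𝕜 H x) = -(1 / 2) * ∫ a, conj (deriv η a) *
        ((|a| ^ (2 * (H : ℝ)) - |a - x| ^ (2 * (H : ℝ)) : ℝ) : 𝕜) := by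
  refine tendsto_nhds_unique (tendsto_const_nhds.inner (tendsto_mollStep x)) ?_
  simp only [inner_toHSpace]
  exact tendsto_hForm_mollStep H.2.1 H.2.2 η x

/-! ### Schwartz functions as superpositions of steps -/

theorem integral_deriv_eq_zero (η : 𝓢(ℝ, 𝕜)) : ∫ x, deriv η x = 0 :=
  integral_eq_zero_of_hasDerivAt_of_integrable (fun _ => η.differentiableAt.hasDerivAt)
    (SchwartzMap.derivCLM 𝕜 𝕜 η).integrable η.integrable

theorem integrable_deriv (η : 𝓢(ℝ, 𝕜)) : Integrable (deriv η) :=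
  (SchwartzMap.derivCLM 𝕜 𝕜 η).integrable

/-- Bochner integrals in `𝓗_H` need real scalars, obtained here by restriction from `𝕜`. -/
noncomputable instance HSpace.instNormedSpaceReal : NormedSpace ℝ (HSpace 𝕜 H) :=
  NormedSpace.restrictScalars ℝ 𝕜 (HSpace 𝕜 H)

instance HSpace.instIsScalarTowerReal : IsScalarTower ℝ 𝕜 (HSpace 𝕜 H) where
  smul_assoc r k v := by
    rw [Algebra.smul_def, mul_smul]
    rfl

theorem integrable_deriv_smul_stepVec (η : 𝓢(ℝ, 𝕜)) :
    Integrable fun x => deriv η x • stepVec 𝕜 H x := by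
  have hK := stepVec_isFBMCurve (𝕜 := 𝕜) (H := H)
  refine (integrable_deriv_mul η).mono'
    ((continuous_deriv η).smul (hK.continuous H.2.1)).aestronglyMeasurable
    (Eventually.of_forall fun x => ?_)
  rw [norm_smul, hK.norm_eq H.2.1, mul_comm]
  refine mul_le_mul_of_nonneg_right ?_ (norm_nonneg _)
  calc |x| ^ (H : ℝ) ≤ (1 + |x|) ^ (H : ℝ) :=
        Real.rpow_le_rpow (abs_nonneg _) (by linarith) H.2.1.le
    _ ≤ (1 + |x|) ^ ((2 : ℕ) : ℝ) :=
        Real.rpow_le_rpow_of_exponent_le (by linarith [abs_nonneg x])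
          (by push_cast; linarith [H.2.2])
    _ = _ := Real.rpow_natCast _ _

/-- As functions, `-∫ η'(x) K_x dx = η`. In `𝓗_H` this is checked against Schwartz functions: the
term with `|a| ^ (2H)` carries the factor `∫ η' = 0`, and the rest is `hForm` after Fubini. -/
theorem toHSpace_eq_integral (η : 𝓢(ℝ, 𝕜)) :
    toHSpace H η = -∫ x, deriv η x • stepVec 𝕜 H x := by
  refine (denseRange_toHSpace H).eq_of_inner_right 𝕜 fun ζ => ?_
  rw [inner_neg_right, ← integral_inner (integrable_deriv_smul_stepVec η), inner_toHSpace]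
  simp only [inner_smul_right, inner_stepVec]
  have hi := integrable_hForm H.2.1 H.2.2 ζ η
  have hc := continuous_abs_rpow H.2.1
  have hconj : Continuous fun a => conj (deriv ζ a) :=
    RCLike.continuous_conj.comp (continuous_deriv ζ)
  have hbd : ∀ y, Integrable fun a => conj (deriv ζ a) *
      ((|a - y| ^ (2 * (H : ℝ)) : ℝ) : 𝕜) := fun y => by
    refine ((integrable_deriv_mul ζ).const_mul ((1 + |y|) ^ 2)).mono' (hconj.mul
      (RCLike.continuous_ofReal.comp (hc.comp
        (continuous_id.sub continuous_const)))).aestronglyMeasurable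
      (Eventually.of_forall fun a => ?_)
    rw [norm_mul, RCLike.norm_conj, RCLike.norm_ofReal,
      abs_of_nonneg (Real.rpow_nonneg (abs_nonneg _) _)]
    calc _ ≤ ‖deriv ζ a‖ * ((1 + |a|) ^ 2 * (1 + |y|) ^ 2) :=
          mul_le_mul_of_nonneg_left (abs_sub_rpow_le H.2.1 H.2.2 a y) (norm_nonneg _)
      _ = _ := by ring
  have hb0 := hbd 0
  simp only [sub_zero] at hb0
  have hsplit : ∀ y, deriv η y * (-(1 / 2) * ∫ a, conj (deriv ζ a) *
        ((|a| ^ (2 * (H : ℝ)) - |a - y| ^ (2 * (H : ℝ)) : ℝ) : 𝕜))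
      = deriv η y * (-(1 / 2) * ∫ a, conj (deriv ζ a) * ((|a| ^ (2 * (H : ℝ)) : ℝ) : 𝕜))
        + (1 / 2) * ∫ a, conj (deriv ζ a) * deriv η y *
          ((|a - y| ^ (2 * (H : ℝ)) : ℝ) : 𝕜) := fun y => by
    have e : ∫ a, conj (deriv ζ a) *
        ((|a| ^ (2 * (H : ℝ)) - |a - y| ^ (2 * (H : ℝ)) : ℝ) : 𝕜)
        = (∫ a, conj (deriv ζ a) * ((|a| ^ (2 * (H : ℝ)) : ℝ) : 𝕜))
          - ∫ a, conj (deriv ζ a) * ((|a - y| ^ (2 * (H : ℝ)) : ℝ) : 𝕜) := by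
      rw [← integral_sub hb0 (hbd y)]
      refine integral_congr_ae (Eventually.of_forall fun a => ?_)
      simp only
      push_cast
      ring
    have e' : ∫ a, conj (deriv ζ a) * deriv η y * ((|a - y| ^ (2 * (H : ℝ)) : ℝ) : 𝕜)
        = deriv η y * ∫ a, conj (deriv ζ a) * ((|a - y| ^ (2 * (H : ℝ)) : ℝ) : 𝕜) := by
      rw [← integral_const_mul]
      refine integral_congr_ae (Eventually.of_forall fun a => ?_)
      simp only
      ring
    rw [e, e']
    ring
  simp only [hsplit]
  rw [integral_add ((integrable_deriv η).mul_const _) (hi.integral_prod_right.const_mul _),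
    integral_mul_const, integral_deriv_eq_zero, zero_mul, zero_add, integral_const_mul, hForm,
    integral_integral_swap hi]
  ring

theorem inner_toHSpace_eq_integral (η : 𝓢(ℝ, 𝕜)) (v : HSpace 𝕜 H) :
    inner 𝕜 (toHSpace H η) v = -∫ x, conj (deriv η x) * inner 𝕜 (stepVec 𝕜 H x) v := by
  rw [toHSpace_eq_integral, inner_neg_left, ← inner_conj_symm,
    ← integral_inner (integrable_deriv_smul_stepVec η), ← integral_conj]
  simp only [inner_smul_right, map_mul, inner_conj_symm]

end curve
end FracBM

namespace FracBM

open Filter Topology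

/-! ### The kernel of the inversion -/

theorem intervalIntegrable_comp_const_sub_mul {h : ℝ → ℝ}
    (hi : ∀ a b, IntervalIntegrable h volume a b) (c x a b : ℝ) :
    IntervalIntegrable (fun t => h (c - t * x)) volume a b := by
  rcases eq_or_ne x 0 with rfl | hx
  · simp
  have h1 := (hi (c - x * a) (c - x * b)).comp_sub_left c
  have h2 := h1.comp_mul_left (c := x)
  rw [sub_sub_cancel, sub_sub_cancel, mul_div_cancel_left₀ _ hx, mul_div_cancel_left₀ _ hx] at h2
  simpa only [mul_comm] using h2

/-- The kernel `(1 - sgn (1 - a x) * |1 - a x| ^ (2 H - 1)) / a`. -/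
noncomputable def invKernel (H x a : ℝ) : ℝ := (1 - signedKernel H (1 - a * x)) / a

theorem measurable_invKernel (H x : ℝ) : Measurable (invKernel H x) :=
  (measurable_const.sub ((measurable_signedKernel H).comp (by fun_prop))).div measurable_id

/-- The power `t ^ r` lies between `t⁻¹` and `t`, and `|1 - t⁻¹| = |1 - t| / t ≤ 2 |1 - t|` for `t ≥
1/2`. -/
theorem abs_one_sub_rpow_le {r t : ℝ} (h1 : -1 ≤ r) (h2 : r ≤ 1) (ht : 1 / 2 ≤ t) :
    |1 - t ^ r| ≤ 2 * |1 - t| := by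
  have h0 : 0 < t := by linarith
  have hinv : t * t⁻¹ = 1 := mul_inv_cancel₀ h0.ne'
  have hip : 0 < t⁻¹ := inv_pos.mpr h0
  rcases le_total 1 t with h | h
  · have e1 : t ^ r ≤ t := by simpa using Real.rpow_le_rpow_of_exponent_le h h2
    have e2 : t⁻¹ ≤ t ^ r := by
      simpa [Real.rpow_neg_one] using Real.rpow_le_rpow_of_exponent_le h h1
    rw [abs_of_nonpos (by linarith : 1 - t ≤ 0), abs_le]
    constructor <;> nlinarith
  · have e1 : t ≤ t ^ r := by simpa using Real.rpow_le_rpow_of_exponent_ge h0 h h2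
    have e2 : t ^ r ≤ t⁻¹ := by
      simpa [Real.rpow_neg_one] using Real.rpow_le_rpow_of_exponent_ge h0 h h1
    rw [abs_of_nonneg (by linarith : 0 ≤ 1 - t), abs_le]
    constructor <;> nlinarith

/-- The division by `a` causes no singularity at `0`: for `|a x| < 1/2` the numerator is of order `a
x`, and for `|a x| ≥ 1/2` the factor `2 |a x| ≥ 1` makes the triangle inequality sufficient. Only
the integrable singularity at `a x = 1` can remain. -/
theorem abs_invKernel_le {H : ℝ} (h0 : 0 < H) (h1 : H < 1) (x a : ℝ) :
    |invKernel H x a| ≤ 2 * |x| * (1 + |1 - a * x| ^ (2 * H - 1)) := by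
  have hp := Real.rpow_nonneg (abs_nonneg (1 - a * x)) (2 * H - 1)
  rcases eq_or_ne a 0 with rfl | ha
  · rw [invKernel, div_zero, abs_zero]; positivity
  rw [invKernel, abs_div, div_le_iff₀ (abs_pos.mpr ha)]
  have hs : |a * x| = |x| * |a| := by rw [abs_mul, mul_comm]
  suffices h : |1 - signedKernel H (1 - a * x)|
      ≤ 2 * |a * x| * (1 + |1 - a * x| ^ (2 * H - 1)) by
    rw [hs] at h; linarith
  generalize a * x = s at hp
  rcases le_or_gt (1 / 2) |s| with h | h
  · have e1 := abs_signedKernel_le H (1 - s)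
    have e2 := abs_sub 1 (signedKernel H (1 - s))
    rw [abs_one] at e2
    nlinarith
  · have hs' := abs_lt.mp h
    have hpos : 0 < 1 - s := by linarith [hs'.2]
    have e := abs_one_sub_rpow_le (r := 2 * H - 1) (t := 1 - s) (by linarith) (by linarith)
      (by linarith [hs'.2])
    rw [sub_sub_cancel] at e
    rw [signedKernel, Real.sign_of_pos hpos, one_mul, abs_of_pos hpos]
    rw [abs_of_pos hpos] at hp
    nlinarith [abs_nonneg s]

theorem intervalIntegrable_invKernel {H : ℝ} (h0 : 0 < H) (h1 : H < 1) (x a b : ℝ) :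
    IntervalIntegrable (invKernel H x) volume a b := by
  have hi := ((intervalIntegrable_const (c := (1 : ℝ)) (μ := volume) (a := a) (b := b)).add
    (intervalIntegrable_comp_const_sub_mul
      (intervalIntegrable_abs_rpow (r := 2 * H - 1) (by linarith)) 1 x a b)).const_mul (2 * |x|)
  refine hi.mono_fun (measurable_invKernel H x).aestronglyMeasurable
    (Eventually.of_forall fun t => ?_)
  exact (abs_invKernel_le h0 h1 x t).trans (le_abs_self _)

theorem mul_setIntegral_comp_const_sub_mul {h : ℝ → ℝ} (hn : ∀ t, 0 ≤ h t) (x a b : ℝ) :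
    |x| * ∫ t in uIoc a b, h (1 - t * x) = ∫ t in uIoc (1 - a * x) (1 - b * x), h t := by
  have e := congrArg abs (intervalIntegral.mul_integral_comp_sub_mul (a := a) (b := b) (f := h) x 1)
  rw [abs_mul, intervalIntegral.abs_integral_eq_abs_integral_uIoc,
    intervalIntegral.abs_integral_eq_abs_integral_uIoc, abs_of_nonneg
      (setIntegral_nonneg measurableSet_uIoc fun _ _ => hn _),
    abs_of_nonneg (setIntegral_nonneg measurableSet_uIoc fun _ _ => hn _),
    uIoc_comm (1 - x * b)] at e
  simpa only [mul_comm] using e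

theorem one_add_mul_rpow_le {H : ℝ} (h1 : H < 1) {M : ℝ} (hM : 0 ≤ M) (x : ℝ) :
    (1 + M * |x|) ^ (2 * H) ≤ (1 + M) ^ 2 * (1 + |x|) ^ 2 := by
  have hx := abs_nonneg x
  have hMx := mul_nonneg hM hx
  calc (1 + M * |x|) ^ (2 * H) ≤ (1 + M * |x|) ^ ((2 : ℕ) : ℝ) :=
        Real.rpow_le_rpow_of_exponent_le (by linarith) (by push_cast; linarith)
    _ = (1 + M * |x|) ^ 2 := Real.rpow_natCast _ _
    _ ≤ ((1 + M) * (1 + |x|)) ^ 2 := pow_le_pow_left₀ (by linarith) (by nlinarith) 2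
    _ = _ := by ring

/-- The factor `|x|` in `abs_invKernel_le` is the Jacobian of `t ↦ 1 - t x`. After substitution the
growth in `x` is at most quadratic, hence integrable against the derivative of a Schwartz function.
-/
theorem setIntegral_abs_invKernel_le {H : ℝ} (h0 : 0 < H) (h1 : H < 1) (a b : ℝ) :
    ∃ C, ∀ x, ∫ t in uIoc a b, |invKernel H x t| ≤ C * (1 + |x|) ^ 2 := by
  set M := |a| + |b|
  have hM : 0 ≤ M := by positivity
  refine ⟨2 * |b - a| + 2 * ((1 + M) ^ 2 / H), fun x => ?_⟩
  have hx := abs_nonneg x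
  have hi := intervalIntegrable_comp_const_sub_mul
    (intervalIntegrable_abs_rpow (r := 2 * H - 1) (by linarith)) 1 x a b
  have hi' := ((intervalIntegrable_const (c := (1 : ℝ)) (μ := volume)
    (a := a) (b := b)).add hi).const_mul (2 * |x|)
  have hle : ∫ t in uIoc a b, |invKernel H x t|
      ≤ ∫ t in uIoc a b, 2 * |x| * (1 + |1 - t * x| ^ (2 * H - 1)) :=
    setIntegral_mono (intervalIntegrable_iff.mp (intervalIntegrable_invKernel h0 h1 x a b)).abs
      (intervalIntegrable_iff.mp hi') fun t => abs_invKernel_le h0 h1 x t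
  have hsplit : ∫ t in uIoc a b, 2 * |x| * (1 + |1 - t * x| ^ (2 * H - 1))
      = 2 * |x| * |b - a| + 2 * ∫ t in uIoc (1 - a * x) (1 - b * x), |t| ^ (2 * H - 1) := by
    rw [integral_const_mul, integral_add (intervalIntegrable_iff.mp intervalIntegrable_const)
      (intervalIntegrable_iff.mp hi), ← mul_setIntegral_comp_const_sub_mul
        (h := fun t => |t| ^ (2 * H - 1)) fun t => Real.rpow_nonneg (abs_nonneg _) _]
    rw [setIntegral_const, smul_eq_mul, mul_one, measureReal_def, Real.volume_uIoc,
      ENNReal.toReal_ofReal (abs_nonneg _)]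
    ring
  have hR : ∀ c, |c| ≤ M → |1 - c * x| ≤ 1 + M * |x| := fun c hc => by
    have h := abs_sub 1 (c * x)
    rw [abs_one, abs_mul] at h
    nlinarith
  have hb := (setIntegral_abs_rpow_le h0 (hR a (by simp [M])) (hR b (by simp [M]))).trans
    (div_le_div_of_nonneg_right (one_add_mul_rpow_le h1 hM x) h0.le)
  have hx2 : |x| * |b - a| ≤ |b - a| * (1 + |x|) ^ 2 := by
    rw [mul_comm]
    exact mul_le_mul_of_nonneg_left (by nlinarith) (abs_nonneg _)
  calc _ ≤ _ := hle
    _ = _ := hsplit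
    _ ≤ 2 * (|b - a| * (1 + |x|) ^ 2) + 2 * ((1 + M) ^ 2 * (1 + |x|) ^ 2 / H) := by linarith
    _ = _ := by ring

/-- The integral of `d/dr C^H(r w, 1)` over `(0, 1)` is `C^H(w, 1)`. Away from the singular points
the integrands agree: `2H C^H(r w, 1) / r` minus this derivative is `H * invKernel H w r`. The
right-hand side is the shape of the Cayley transform. -/
theorem integral_invKernel {H : ℝ} (h0 : 0 < H) (h1 : H < 1) (w : ℝ) :
    H * ∫ r in (0 : ℝ)..1, invKernel H w r
      = 2 * H * (∫ r in (0 : ℝ)..1, r⁻¹ * fbmCov H (r * w) 1) - fbmCov H w 1 := by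
  rcases eq_or_ne w 0 with rfl | hw
  · have : ∀ r, invKernel H 0 r = 0 := fun r => by
      simp [invKernel, signedKernel]
    simp [this, fbmCov_zero_left h0]
  have i1 : IntervalIntegrable (fun r => signedKernel H (r * w)) volume 0 1 := by
    simpa using intervalIntegrable_comp_const_sub_mul (intervalIntegrable_signedKernel h0) 0
      (-w) 0 1
  have i2 := intervalIntegrable_comp_const_sub_mul (intervalIntegrable_signedKernel h0) 1 w 0 1
  have i3 := ((i1.add i2).mul_const (H * w))
  have i4 := (intervalIntegrable_invKernel h0 h1 w 0 1).const_mul H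
  have hc : Continuous fun r : ℝ => fbmCov H (r * w) 1 :=
    (continuous_fbmCov h0).comp ((continuous_mul_const w).prodMk continuous_const)
  have hftc := integral_eq_of_hasDerivAt_off_countable (a := 0) (b := 1)
    (fun r : ℝ => fbmCov H (r * w) 1)
    (fun r => (signedKernel H (r * w) + signedKernel H (1 - r * w)) * (H * w))
    -- The excluded points are those where `r w` or `1 - r w` vanishes.
    (s := {0, w⁻¹}) (by simp) hc.continuousOn (fun r hr => ?_) i3
  · rw [one_mul, zero_mul, fbmCov_zero_left h0, sub_zero] at hftc
    rw [← hftc, ← intervalIntegral.integral_const_mul, ← intervalIntegral.integral_const_mul,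
      eq_sub_iff_add_eq, ← intervalIntegral.integral_add i4 i3]
    refine intervalIntegral.integral_congr_ae ?_
    have hn : ∀ᵐ r : ℝ, r ≠ w⁻¹ := by simp [ae_iff, measure_singleton]
    filter_upwards [hn] with r hr hr1
    rw [uIoc_of_le zero_le_one] at hr1
    have hr0 := hr1.1.ne'
    have hrw : r * w ≠ 0 := mul_ne_zero hr0 hw
    have hrw1 : 1 - r * w ≠ 0 := fun h => hr (by field_simp; linarith)
    have e1 := signedKernel_mul_self (H := H) hrw
    have e2 := signedKernel_mul_self (H := H) hrw1
    rw [fbmCov, ← e1, abs_one, Real.one_rpow, abs_sub_comm, ← e2, invKernel]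
    field_simp
    ring
  · have hr0 : r ≠ 0 := fun h => hr.2 (by simp [h])
    have hrw : r * w ≠ 0 := mul_ne_zero hr0 hw
    have hrw1 : r * w - 1 ≠ 0 := fun h => hr.2 (by
      right; rw [mem_singleton_iff]; field_simp; linarith)
    have d1 := (hasDerivAt_abs_rpow (H := H) hrw).comp r ((hasDerivAt_id r).mul_const w)
    have d2 := (hasDerivAt_abs_rpow (H := H) hrw1).comp r
      (((hasDerivAt_id r).mul_const w).sub_const 1)
    have d := ((d1.add_const (|(1 : ℝ)| ^ (2 * H))).sub d2).const_mul (1 / 2)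
    refine d.congr_deriv ?_
    have hneg : signedKernel H (1 - r * w) = -signedKernel H (r * w - 1) := by
      rw [signedKernel, signedKernel, ← neg_sub, Real.sign_neg, abs_neg]; ring
    rw [hneg]
    ring

end FracBM

namespace FracBM

open Filter Topology

section elements
variable {𝕜 : Type*} [RCLike 𝕜] {H : Ioo (0 : ℝ) 1}

/-! ### Testing against the curve of indicator functions -/

/-- The difference `sgn (z - γ) |z - γ| ^ (2 H - 1) - sgn (z - x) |z - x| ^ (2 H - 1)`. -/
noncomputable def kernelDiff (H γ x z : ℝ) : ℝ := signedKernel H (z - γ) - signedKernel H (z - x)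

variable (𝕜) in
theorem measurable_kernelDiff (H γ : ℝ) :
    Measurable fun p : ℝ × ℝ => ((kernelDiff H γ p.1 p.2 : ℝ) : 𝕜) :=
  RCLike.measurable_ofReal.comp
    (((measurable_signedKernel H).comp (measurable_snd.sub_const γ)).sub
      ((measurable_signedKernel H).comp (measurable_snd.sub measurable_fst)))

/-- The function `f` is the vector `v`, tested against the increments of `stepVec 𝕜 H` from the
base point `γ`. -/
structure IsStepElement (γ : ℝ) (f : ℝ → 𝕜) (v : HSpace 𝕜 H) : Prop where
  memLp : MemLp f (ENNReal.ofReal (1 / (H : ℝ))) volume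
  integrable : ∀ x, Integrable fun z => ((kernelDiff H γ x z : ℝ) : 𝕜) * f z
  bound : ∃ C, ∀ x, ∫ z, ‖((kernelDiff H γ x z : ℝ) : 𝕜) * f z‖ ≤ C * (1 + |x|) ^ 2
  inner_eq : ∀ x, inner 𝕜 (stepVec 𝕜 H x - stepVec 𝕜 H γ) v
    = ((H : ℝ) : 𝕜) * ∫ z, ((kernelDiff H γ x z : ℝ) : 𝕜) * f z

namespace IsStepElement
variable {γ : ℝ} {f g : ℝ → 𝕜} {v w : HSpace 𝕜 H}

theorem congr (hf : IsStepElement γ f v) (h : f =ᵐ[volume] g) : IsStepElement γ g v := by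
  have hc : ∀ x, (fun z => ((kernelDiff H γ x z : ℝ) : 𝕜) * f z) =ᵐ[volume]
      fun z => ((kernelDiff H γ x z : ℝ) : 𝕜) * g z := fun x => by
    filter_upwards [h] with z hz
    rw [hz]
  refine ⟨hf.memLp.ae_eq h, fun x => (hf.integrable x).congr (hc x), ?_, fun x => ?_⟩
  · obtain ⟨C, hC⟩ := hf.bound
    refine ⟨C, fun x => (integral_congr_ae ?_).trans_le (hC x)⟩
    filter_upwards [hc x] with z hz
    rw [hz]
  · rw [hf.inner_eq, integral_congr_ae (hc x)]

theorem const_smul (hf : IsStepElement γ f v) (c : 𝕜) :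
    IsStepElement γ (fun z => c * f z) (c • v) := by
  have hc : ∀ x, (fun z => ((kernelDiff H γ x z : ℝ) : 𝕜) * (c * f z))
      = fun z => c * (((kernelDiff H γ x z : ℝ) : 𝕜) * f z) := fun x => by
    funext z; ring
  refine ⟨hf.memLp.const_mul c, fun x => ?_, ?_, fun x => ?_⟩
  · rw [hc]; exact (hf.integrable x).const_mul c
  · obtain ⟨C, hC⟩ := hf.bound
    refine ⟨‖c‖ * C, fun x => ?_⟩
    have : ∀ z, ‖((kernelDiff H γ x z : ℝ) : 𝕜) * (c * f z)‖
        = ‖c‖ * ‖((kernelDiff H γ x z : ℝ) : 𝕜) * f z‖ := fun z => by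
      rw [← norm_mul]; congr 1; ring
    simp only [this, integral_const_mul]
    rw [mul_assoc]
    exact mul_le_mul_of_nonneg_left (hC x) (norm_nonneg c)
  · rw [inner_smul_right, hf.inner_eq, hc, integral_const_mul]
    ring

/-- Superpose the tests with weight `η'`; the quadratic bound justifies Fubini. Since `∫ η' = 0`,
subtracting the base-point vector changes nothing, and the kernel at `γ` drops out of the inner
integral. -/
theorem isElement (hf : IsStepElement γ f v) : IsElement f v := by
  refine ⟨hf.memLp, fun η => ?_⟩
  obtain ⟨C, hC⟩ := hf.bound
  have hconj : ∀ {μ : Measure ℝ} {g : ℝ → 𝕜}, Integrable g μ → Integrable (fun x => conj (g x)) μ :=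
    fun hg => (RCLike.conjCLE (K := 𝕜)).toContinuousLinearMap.integrable_comp hg
  have hη := hconj (integrable_deriv η)
  have hη0 : ∫ x, conj (deriv η x) = 0 := by
    rw [integral_conj, integral_deriv_eq_zero, map_zero]
  let G : ℝ → ℝ → 𝕜 := fun x z => conj (deriv η x) * (((kernelDiff H γ x z : ℝ) : 𝕜) * f z)
  have hGm : AEStronglyMeasurable (Function.uncurry G) (volume.prod volume) := by
    have h1 : Measurable fun p : ℝ × ℝ => conj (deriv η p.1) :=
      (RCLike.continuous_conj.comp (continuous_deriv η)).measurable.comp measurable_fst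
    exact h1.aestronglyMeasurable.mul ((measurable_kernelDiff 𝕜 H γ).aestronglyMeasurable.mul
      hf.memLp.1.comp_snd)
  have hnorm : ∀ x, ∫ z, ‖G x z‖
      = ‖deriv η x‖ * ∫ z, ‖((kernelDiff H γ x z : ℝ) : 𝕜) * f z‖ := fun x => by
    simp only [G, norm_mul (conj _), RCLike.norm_conj, integral_const_mul]
  have hG : Integrable (Function.uncurry G) (volume.prod volume) := by
    rw [integrable_prod_iff hGm]
    refine ⟨Eventually.of_forall fun x =>
      Integrable.const_mul (hf.integrable x) (conj (deriv η x)), ?_⟩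
    refine ((integrable_deriv_mul η).const_mul C).mono' hGm.norm.integral_prod_right'
      (Eventually.of_forall fun x => ?_)
    simp only [Function.uncurry]
    rw [hnorm, norm_mul, norm_norm, Real.norm_of_nonneg (integral_nonneg fun z => norm_nonneg _)]
    calc _ ≤ ‖deriv η x‖ * (C * (1 + |x|) ^ 2) :=
          mul_le_mul_of_nonneg_left (hC x) (norm_nonneg _)
      _ = _ := by ring
  have hinn : Integrable fun x => conj (deriv η x) * inner 𝕜 (stepVec 𝕜 H x) v := by
    have h := (integrable_deriv_smul_stepVec (H := H) η).inner_const (𝕜 := 𝕜) v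
    simpa only [inner_smul_left] using h
  have hstep : inner 𝕜 (toHSpace H η) v = -∫ x, ((H : ℝ) : 𝕜) * ∫ z, G x z := by
    have : ∀ x, ((H : ℝ) : 𝕜) * ∫ z, G x z = conj (deriv η x) * inner 𝕜 (stepVec 𝕜 H x) v
        - conj (deriv η x) * inner 𝕜 (stepVec 𝕜 H γ) v := fun x => by
      rw [← mul_sub, ← inner_sub_left, hf.inner_eq, integral_const_mul]
      ring
    simp only [this]
    rw [integral_sub hinn (hη.mul_const _), integral_mul_const, hη0, zero_mul, sub_zero,
      inner_toHSpace_eq_integral]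
  rw [hstep, integral_const_mul, integral_integral_swap hG, ← mul_neg, ← integral_neg]
  congr 1
  refine integral_congr_ae ?_
  filter_upwards [hG.prod_left_ae] with z hz
  simp only [Function.uncurry] at hz
  -- Fubini only provides integrability of the section multiplied by `f z`; where `f z ≠ 0` this
  -- factor can be divided out.
  rcases eq_or_ne (f z) 0 with h0 | h0
  · simp [G, h0]
  have hd : Integrable fun x => conj (deriv η x) * ((kernelDiff H γ x z : ℝ) : 𝕜) := by
    refine (hz.mul_const (f z)⁻¹).congr (Eventually.of_forall fun x => ?_)
    simp only [G]
    field_simp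
  have hk : ∀ x, conj (deriv η x) * ((Real.sign (z - x) * |x - z| ^ (2 * (H : ℝ) - 1) : ℝ) : 𝕜)
      = conj (deriv η x) * ((signedKernel H (z - γ) : ℝ) : 𝕜)
        - conj (deriv η x) * ((kernelDiff H γ x z : ℝ) : 𝕜) := fun x => by
    rw [abs_sub_comm x z, ← signedKernel, kernelDiff]
    push_cast
    ring
  simp only [hk]
  rw [integral_sub (hη.mul_const _) hd, integral_mul_const, hη0, zero_mul, zero_sub, neg_mul,
    ← integral_mul_const]
  simp only [G, mul_assoc]

end IsStepElement

theorem IsElement.unique {f : ℝ → 𝕜} {v w : HSpace 𝕜 H} (hv : IsElement f v)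
    (hw : IsElement f w) : v = w :=
  (denseRange_toHSpace H).eq_of_inner_right 𝕜 fun η => by rw [hv.2, hw.2]

/-! ### Step functions -/

variable (𝕜) in
/-- The indicator function of the interval between `p` and `q`, with a sign for the
orientation. -/
noncomputable def stepFun (p q : ℝ) : ℝ → 𝕜 :=
  indicator (uIoc p q) fun _ => if p ≤ q then 1 else -1

theorem norm_stepFun (p q z : ℝ) : ‖stepFun 𝕜 p q z‖ = indicator (uIoc p q) (fun _ => 1) z := by
  rw [stepFun, norm_indicator_eq_indicator_norm]
  split_ifs <;> simp

theorem mul_stepFun (p q : ℝ) (g : ℝ → 𝕜) : (fun z => g z * stepFun 𝕜 p q z) =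
    indicator (uIoc p q) fun z => g z * if p ≤ q then 1 else -1 := by
  funext z
  rw [stepFun]
  by_cases hz : z ∈ uIoc p q <;> simp [hz]

theorem integrable_mul_stepFun {p q : ℝ} {g : ℝ → 𝕜} (hg : IntervalIntegrable g volume p q) :
    Integrable fun z => g z * stepFun 𝕜 p q z := by
  rw [mul_stepFun, integrable_indicator_iff measurableSet_uIoc]
  exact (intervalIntegrable_iff.mp hg).mul_const _

theorem integral_mul_stepFun (p q : ℝ) (g : ℝ → 𝕜) :
    ∫ z, g z * stepFun 𝕜 p q z = ∫ z in p..q, g z := by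
  rw [mul_stepFun, integral_indicator measurableSet_uIoc, integral_mul_const,
    intervalIntegral.intervalIntegral_eq_integral_uIoc]
  split_ifs <;> simp

theorem integral_ofReal_mul_stepFun (p q : ℝ) (g : ℝ → ℝ) :
    ∫ z, ((g z : ℝ) : 𝕜) * stepFun 𝕜 p q z = ((∫ z in p..q, g z : ℝ) : 𝕜) := by
  rw [integral_mul_stepFun, RCLike.intervalIntegral_ofReal]

theorem integral_norm_mul_stepFun (p q : ℝ) (g : ℝ → 𝕜) :
    ∫ z, ‖g z * stepFun 𝕜 p q z‖ = ∫ z in uIoc p q, ‖g z‖ := by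
  rw [← integral_indicator measurableSet_uIoc]
  congr 1 with z
  rw [norm_mul, norm_stepFun]
  by_cases hz : z ∈ uIoc p q <;> simp [hz]

theorem memLp_stepFun (p q : ℝ) (r : ENNReal) : MemLp (stepFun 𝕜 p q) r volume :=
  memLp_indicator_const r measurableSet_uIoc _ (Or.inr (by simp [Real.volume_uIoc]))

theorem intervalIntegrable_kernelDiff {H : ℝ} (h0 : 0 < H) (γ x p q : ℝ) :
    IntervalIntegrable (kernelDiff H γ x) volume p q :=
  (intervalIntegrable_signedKernel_sub h0 γ p q).sub (intervalIntegrable_signedKernel_sub h0 x p q)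

theorem integral_kernelDiff {H : ℝ} (h0 : 0 < H) (γ x p q : ℝ) :
    H * ∫ z in p..q, kernelDiff H γ x z
      = fbmCov H (x - γ) (q - γ) - fbmCov H (x - γ) (p - γ) := by
  simp only [kernelDiff]
  rw [intervalIntegral.integral_sub (intervalIntegrable_signedKernel_sub h0 γ p q)
    (intervalIntegrable_signedKernel_sub h0 x p q), integral_signedKernel_sub h0,
    integral_signedKernel_sub h0, fbmCov, fbmCov, sub_sub_sub_cancel_right,
    sub_sub_sub_cancel_right, abs_sub_comm q x, abs_sub_comm p x]
  field_simp
  ring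

theorem setIntegral_abs_signedKernel_sub_le {H : ℝ} (h0 : 0 < H) (h1 : H < 1) (p q x : ℝ) :
    ∫ z in uIoc p q, |signedKernel H (z - x)|
      ≤ (1 + (1 + (|p| + |q|))) ^ 2 / H * (1 + |x|) ^ 2 := by
  set M := 1 + (|p| + |q|) with hM
  have hM1 : 1 ≤ M := by simp only [hM]; linarith [abs_nonneg p, abs_nonneg q]
  have hi : IntervalIntegrable (fun z => |z - x| ^ (2 * H - 1)) volume p q := by
    simpa using (intervalIntegrable_abs_rpow (r := 2 * H - 1) (by linarith)
      (p - x) (q - x)).comp_sub_right x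
  have e1 : ∫ z in uIoc p q, |signedKernel H (z - x)|
      ≤ ∫ z in uIoc p q, |z - x| ^ (2 * H - 1) :=
    setIntegral_mono
      (intervalIntegrable_iff.mp (intervalIntegrable_signedKernel_sub h0 x p q)).abs
      (intervalIntegrable_iff.mp hi) fun z => abs_signedKernel_le H (z - x)
  have e2 : ∫ z in uIoc p q, |z - x| ^ (2 * H - 1)
      = ∫ t in uIoc (p - x) (q - x), |t| ^ (2 * H - 1) := by
    have e := congrArg abs (intervalIntegral.integral_comp_sub_right (a := p) (b := q)
      (fun t : ℝ => |t| ^ (2 * H - 1)) x)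
    rwa [intervalIntegral.abs_integral_eq_abs_integral_uIoc,
      intervalIntegral.abs_integral_eq_abs_integral_uIoc, abs_of_nonneg
        (setIntegral_nonneg measurableSet_uIoc fun _ _ => Real.rpow_nonneg (abs_nonneg _) _),
      abs_of_nonneg (setIntegral_nonneg measurableSet_uIoc
        fun _ _ => Real.rpow_nonneg (abs_nonneg _) _)] at e
  have hR : ∀ c, |c| ≤ |p| + |q| → |c - x| ≤ M + M * |x| := fun c hc => by
    have h := abs_sub c x
    nlinarith [abs_nonneg x]
  have hb := setIntegral_abs_rpow_le h0 (hR p (by simp)) (hR q (by simp))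
  have hp : (M + M * |x|) ^ (2 * H) ≤ (1 + M) ^ 2 * (1 + |x|) ^ 2 := by
    have hx := abs_nonneg x
    have hMx : 0 ≤ M * |x| := by positivity
    calc (M + M * |x|) ^ (2 * H) ≤ (M + M * |x|) ^ ((2 : ℕ) : ℝ) :=
          Real.rpow_le_rpow_of_exponent_le (by linarith) (by push_cast; linarith)
      _ = (M + M * |x|) ^ 2 := Real.rpow_natCast _ _
      _ ≤ ((1 + M) * (1 + |x|)) ^ 2 := pow_le_pow_left₀ (by linarith) (by nlinarith) 2
      _ = _ := by ring
  calc _ ≤ (M + M * |x|) ^ (2 * H) / H := e1.trans (e2.trans_le hb)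
    _ ≤ (1 + M) ^ 2 * (1 + |x|) ^ 2 / H := div_le_div_of_nonneg_right hp h0.le
    _ = _ := by ring

/-- Integrating the kernel across the step gives differences of `C^H`. The base point `0`
contributes nothing, as `C^H(0, ·) = 0`. -/
theorem isStepElement_stepFun (p q : ℝ) :
    IsStepElement 0 (stepFun 𝕜 p q) (stepVec 𝕜 H q - stepVec 𝕜 H p) := by
  have hK := stepVec_isFBMCurve (𝕜 := 𝕜) (H := H)
  have hi := fun x => intervalIntegrable_kernelDiff H.2.1 0 x p q
  refine ⟨memLp_stepFun p q _, fun x => integrable_mul_stepFun ?_, ?_, fun x => ?_⟩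
  · exact intervalIntegrable_iff.mpr (intervalIntegrable_iff.mp (hi x)).ofReal
  · set D := (1 + (1 + (|p| + |q|))) ^ 2 / (H : ℝ) with hD
    have hD0 : 0 ≤ D := div_nonneg (by positivity) H.2.1.le
    -- One `D` for each of the two kernels, based at `0` and at `x`.
    refine ⟨2 * D, fun x => ?_⟩
    rw [integral_norm_mul_stepFun]
    simp only [RCLike.norm_ofReal]
    have a0 := (intervalIntegrable_iff.mp
      (intervalIntegrable_signedKernel_sub H.2.1 0 p q)).abs
    have ax := (intervalIntegrable_iff.mp
      (intervalIntegrable_signedKernel_sub H.2.1 x p q)).abs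
    have e : ∫ z in uIoc p q, |kernelDiff H 0 x z| ≤
        ∫ z in uIoc p q, (|signedKernel H (z - 0)| + |signedKernel H (z - x)|) :=
      setIntegral_mono (intervalIntegrable_iff.mp (hi x)).abs (a0.add ax) fun z => abs_sub _ _
    rw [integral_add a0 ax] at e
    have b0 := setIntegral_abs_signedKernel_sub_le H.2.1 H.2.2 p q 0
    have bx := setIntegral_abs_signedKernel_sub_le H.2.1 H.2.2 p q x
    rw [← hD] at b0 bx
    rw [abs_zero] at b0
    nlinarith [abs_nonneg x, mul_nonneg hD0 (abs_nonneg x), mul_nonneg hD0 (sq_nonneg x)]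
  · rw [integral_ofReal_mul_stepFun, ← RCLike.ofReal_mul,
      integral_kernelDiff H.2.1, inner_sub_left, inner_sub_right, inner_sub_right, hK, hK, hK, hK,
      fbmCov_zero_left H.2.1, fbmCov_zero_left H.2.1]
    simp

end elements
end FracBM

namespace FracBM

open Filter Topology

/-! ### Change of variables along an inversion -/

section inversion
variable {F : Type*} [NormedAddCommGroup F] [NormedSpace ℝ F]

theorem image_add_inv_compl (γ : ℝ) : (fun a : ℝ => γ + a⁻¹) '' {0}ᶜ = {γ}ᶜ := by
  ext z
  simp only [mem_image, mem_compl_iff, mem_singleton_iff]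
  constructor
  · rintro ⟨a, ha, rfl⟩ h
    exact inv_ne_zero ha (by linarith)
  · intro hz
    exact ⟨(z - γ)⁻¹, inv_ne_zero (sub_ne_zero.mpr hz), by simp⟩

theorem hasDerivWithinAt_add_inv (γ : ℝ) : ∀ a ∈ ({0}ᶜ : Set ℝ),
    HasDerivWithinAt (fun a : ℝ => γ + a⁻¹) (-(a ^ 2)⁻¹) {0}ᶜ a := fun _ ha =>
  ((hasDerivAt_inv ha).const_add γ).hasDerivWithinAt

theorem injOn_add_inv (γ : ℝ) : InjOn (fun a : ℝ => γ + a⁻¹) {0}ᶜ := fun _ _ _ _ h =>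
  inv_injective (add_left_cancel h)

theorem integral_eq_integral_add_inv (γ : ℝ) (h : ℝ → F) :
    ∫ z, h z = ∫ a, (a ^ 2)⁻¹ • h (γ + a⁻¹) := by
  have e := integral_image_eq_integral_abs_deriv_smul (measurableSet_singleton 0).compl
    (hasDerivWithinAt_add_inv γ) (injOn_add_inv γ) h
  rw [image_add_inv_compl, restrict_compl_singleton, restrict_compl_singleton] at e
  simpa only [abs_neg, abs_inv, abs_pow, sq_abs] using e

theorem integrable_iff_integrable_add_inv (γ : ℝ) (h : ℝ → F) :
    Integrable h ↔ Integrable fun a => (a ^ 2)⁻¹ • h (γ + a⁻¹) := by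
  have e := integrableOn_image_iff_integrableOn_abs_deriv_smul (measurableSet_singleton 0).compl
    (hasDerivWithinAt_add_inv γ) (injOn_add_inv γ) h
  rw [image_add_inv_compl, IntegrableOn, IntegrableOn, restrict_compl_singleton,
    restrict_compl_singleton] at e
  simpa only [abs_neg, abs_inv, abs_pow, sq_abs] using e

end inversion

section elements
variable {𝕜 : Type*} [RCLike 𝕜] {H : Ioo (0 : ℝ) 1}

/-! ### Inverted step functions -/

variable (𝕜) in
/-- The function `|z - γ| ^ (-2 H)` on the set of `z` with `(z - γ)⁻¹` between `p` and `q`, with a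
sign for the orientation. -/
noncomputable def invStepFun (H γ p q z : ℝ) : 𝕜 :=
  ((|z - γ| ^ (-(2 * H)) : ℝ) : 𝕜) * stepFun 𝕜 p q (z - γ)⁻¹

theorem measurable_stepFun (p q : ℝ) : Measurable (stepFun 𝕜 p q) :=
  measurable_const.indicator measurableSet_uIoc

theorem measurable_invStepFun (H γ p q : ℝ) : Measurable (invStepFun 𝕜 H γ p q) :=
  (RCLike.measurable_ofReal.comp (by fun_prop)).mul
    ((measurable_stepFun p q).comp (by fun_prop))

/-- Because `2H * (1/H) = 2`, the weight raised to the power `1/H` cancels the Jacobian `a ^ (-2)`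
exactly, leaving the indicator function of a bounded interval. -/
theorem memLp_invStepFun (γ p q : ℝ) :
    MemLp (invStepFun 𝕜 H γ p q) (ENNReal.ofReal (1 / (H : ℝ))) volume := by
  have hH := H.2.1
  have hp : 0 < 1 / (H : ℝ) := by positivity
  rw [← integrable_norm_rpow_iff (measurable_invStepFun _ γ p q).aestronglyMeasurable
    (by simpa using hH) ENNReal.ofReal_ne_top, ENNReal.toReal_ofReal hp.le,
    integrable_iff_integrable_add_inv γ]
  have hI : Integrable (indicator (uIoc p q) fun _ => (1 : ℝ)) :=
    (integrable_indicator_iff measurableSet_uIoc).mpr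
      (intervalIntegrable_iff.mp intervalIntegrable_const)
  refine hI.congr ?_
  have hn : ∀ᵐ a : ℝ, a ≠ 0 := by simp [ae_iff, measure_singleton]
  filter_upwards [hn] with a ha
  rw [invStepFun, add_sub_cancel_left, inv_inv, norm_mul, RCLike.norm_ofReal, norm_stepFun,
    abs_of_nonneg (Real.rpow_nonneg (abs_nonneg _) _), smul_eq_mul]
  by_cases hz : a ∈ uIoc p q
  · rw [indicator_of_mem hz, mul_one, abs_inv, ← Real.rpow_mul (by positivity),
      Real.inv_rpow (abs_nonneg _), ← Real.rpow_neg (abs_nonneg _)]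
    have : -(-(2 * (H : ℝ)) * (1 / H)) = (2 : ℕ) := by
      push_cast
      field_simp
    rw [this, Real.rpow_natCast, sq_abs]
    field_simp
  · rw [indicator_of_notMem hz, mul_zero, Real.zero_rpow hp.ne', mul_zero]

/-- With `z = γ + a⁻¹` one has `z - x = a⁻¹ (1 - a (x - γ))`. The common kernel factor at `a⁻¹`
times the weight equals `a`, and the Jacobian turns it into the `1 / a` of `invKernel`. At `a = 0`
division by zero makes both sides `0`. -/
theorem kernelDiff_mul_invStepFun (H γ x p q a : ℝ) :
    (a ^ 2)⁻¹ • (((kernelDiff H γ x (γ + a⁻¹) : ℝ) : 𝕜) * invStepFun 𝕜 H γ p q (γ + a⁻¹))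
      = ((invKernel H (x - γ) a : ℝ) : 𝕜) * stepFun 𝕜 p q a := by
  rcases eq_or_ne a 0 with rfl | ha
  · simp [invKernel]
  have h1 : γ + a⁻¹ - x = a⁻¹ * (1 - a * (x - γ)) := by
    field_simp
    ring
  rw [kernelDiff, invStepFun, add_sub_cancel_left, inv_inv, h1, signedKernel_mul,
    RCLike.real_smul_eq_coe_mul, ← mul_assoc, ← mul_assoc, ← RCLike.ofReal_mul,
    ← RCLike.ofReal_mul, invKernel]
  congr 2
  have e := signedKernel_mul_self (H := H) (inv_ne_zero ha)
  have e2 : |a⁻¹| ^ (2 * H) * |a⁻¹| ^ (-(2 * H)) = 1 := by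
    rw [← Real.rpow_add (abs_pos.mpr (inv_ne_zero ha)), add_neg_cancel, Real.rpow_zero]
  rw [← e] at e2
  have e3 : signedKernel H a⁻¹ * |a⁻¹| ^ (-(2 * H)) = a := by
    linear_combination a * e2
      - signedKernel H a⁻¹ * |a⁻¹| ^ (-(2 * H)) * mul_inv_cancel₀ ha
  calc _ = (a ^ 2)⁻¹ * (1 - signedKernel H (1 - a * (x - γ)))
        * (signedKernel H a⁻¹ * |a⁻¹| ^ (-(2 * H))) := by ring
    _ = _ := by rw [e3]; field_simp

variable (𝕜 H) in
/-- The function `invStepFun 𝕜 H γ 0 u` as an element of `𝓗_H`. -/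
noncomputable def invStepVec (γ u : ℝ) : HSpace 𝕜 H :=
  IsFBMCurve.cayley H
    (fun a : ℝ => ((|a| ^ (2 * (H : ℝ)) : ℝ) : 𝕜) • (stepVec 𝕜 H (γ + a⁻¹) - stepVec 𝕜 H γ)) u

theorem inverted_isFBMCurve (γ : ℝ) : IsFBMCurve 𝕜 H fun a : ℝ =>
    ((|a| ^ (2 * (H : ℝ)) : ℝ) : 𝕜) • (stepVec 𝕜 H (γ + a⁻¹) - stepVec 𝕜 H γ) :=
  (stepVec_isFBMCurve.sub_const H.2.1 γ).inversion H.2.1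

theorem invStepVec_isFBMCurve (γ : ℝ) : IsFBMCurve 𝕜 H (invStepVec 𝕜 H γ) :=
  (inverted_isFBMCurve γ).cayley_isFBMCurve H.2.1

theorem abs_rpow_mul_fbmCov_inv {H : ℝ} (h0 : 0 < H) (a x : ℝ) :
    |a| ^ (2 * H) * fbmCov H x a⁻¹ = fbmCov H (a * x) 1 := by
  rcases eq_or_ne a 0 with rfl | ha
  · rw [zero_mul, fbmCov_zero_left h0, abs_zero, Real.zero_rpow (by linarith), zero_mul]
  · rw [← fbmCov_mul, mul_inv_cancel₀ ha]

theorem integral_invKernel_mul (H x u : ℝ) :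
    ∫ r in (0 : ℝ)..1, invKernel H (u * x) r = ∫ a in (0 : ℝ)..u, invKernel H x a := by
  have h := intervalIntegral.smul_integral_comp_mul_left (a := 0) (b := 1) (invKernel H x) u
  rw [mul_zero, mul_one] at h
  rw [← h, ← intervalIntegral.integral_smul]
  refine intervalIntegral.integral_congr fun r _ => ?_
  rcases eq_or_ne u 0 with rfl | hu
  · simp [invKernel, signedKernel]
  rw [invKernel, invKernel, smul_eq_mul, ← mul_div_assoc, mul_div_mul_left _ _ hu, mul_assoc u,
    mul_left_comm u]

/-- Against `K_x - K_γ` the inverted curve has scalar product `C^H(a (x - γ), 1)`. Its Cayley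
transform is evaluated by `integral_invKernel` with `w = u (x - γ)`, then rescaled to the interval
from `0` to `u`. -/
theorem inner_invStepVec (γ x u : ℝ) :
    inner 𝕜 (stepVec 𝕜 H x - stepVec 𝕜 H γ) (invStepVec 𝕜 H γ u)
      = ((H * ∫ a in (0 : ℝ)..u, invKernel H (x - γ) a : ℝ) : 𝕜) := by
  have hK := stepVec_isFBMCurve (𝕜 := 𝕜) (H := H)
  have hZ : ∀ a : ℝ, inner 𝕜 (stepVec 𝕜 H x - stepVec 𝕜 H γ)
      (((|a| ^ (2 * (H : ℝ)) : ℝ) : 𝕜) • (stepVec 𝕜 H (γ + a⁻¹) - stepVec 𝕜 H γ))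
      = ((fbmCov H (a * (x - γ)) 1 : ℝ) : 𝕜) := fun a => by
    have h := hK.sub_const H.2.1 γ (x - γ) a⁻¹
    simp only [add_sub_cancel] at h
    rw [inner_smul_right, h, ← RCLike.ofReal_mul, abs_rpow_mul_fbmCov_inv H.2.1]
  rw [invStepVec, IsFBMCurve.cayley, inner_sub_right, RCLike.real_smul_eq_coe_smul (K := 𝕜),
    inner_smul_right, (inverted_isFBMCurve γ).inner_logMean_right H.2.1]
  simp only [hZ]
  simp only [← RCLike.ofReal_mul]
  rw [integral_ofReal, ← RCLike.ofReal_mul, ← RCLike.ofReal_sub, ← integral_invKernel_mul,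
    integral_invKernel H.2.1 H.2.2, intervalIntegral.integral_of_le zero_le_one]
  simp only [mul_assoc]

/-- After `z = γ + a⁻¹` every requirement becomes a statement about `invKernel` on the bounded
interval between `p` and `q`. -/
theorem isStepElement_invStepFun (γ p q : ℝ) :
    IsStepElement γ (invStepFun 𝕜 H γ p q) (invStepVec 𝕜 H γ q - invStepVec 𝕜 H γ p) := by
  have hi := fun x => intervalIntegrable_invKernel H.2.1 H.2.2 (x - γ)
  refine ⟨memLp_invStepFun γ p q, fun x => ?_, ?_, fun x => ?_⟩
  · rw [integrable_iff_integrable_add_inv γ]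
    simp only [kernelDiff_mul_invStepFun]
    exact integrable_mul_stepFun
      (intervalIntegrable_iff.mpr (intervalIntegrable_iff.mp (hi x p q)).ofReal)
  · obtain ⟨C, hC⟩ := setIntegral_abs_invKernel_le H.2.1 H.2.2 p q
    have hC0 : 0 ≤ C := by
      have h := (setIntegral_nonneg measurableSet_uIoc fun _ _ => abs_nonneg _).trans (hC 0)
      simpa using h
    refine ⟨C * (1 + |γ|) ^ 2, fun x => ?_⟩
    rw [integral_eq_integral_add_inv γ]
    have : ∀ a : ℝ, (a ^ 2)⁻¹ • ‖((kernelDiff H γ x (γ + a⁻¹) : ℝ) : 𝕜)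
        * invStepFun 𝕜 H γ p q (γ + a⁻¹)‖
        = ‖((invKernel H (x - γ) a : ℝ) : 𝕜) * stepFun 𝕜 p q a‖ := fun a => by
      rw [← kernelDiff_mul_invStepFun, norm_smul, Real.norm_of_nonneg (by positivity), smul_eq_mul]
    simp only [this]
    rw [integral_norm_mul_stepFun]
    simp only [RCLike.norm_ofReal]
    refine (hC (x - γ)).trans ?_
    have h1 : 1 + |x - γ| ≤ (1 + |γ|) * (1 + |x|) := by
      have := abs_sub x γ
      nlinarith [mul_nonneg (abs_nonneg γ) (abs_nonneg x)]
    calc _ ≤ C * ((1 + |γ|) * (1 + |x|)) ^ 2 :=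
          mul_le_mul_of_nonneg_left (pow_le_pow_left₀ (by positivity) h1 2) hC0
      _ = _ := by ring
  · rw [integral_eq_integral_add_inv γ]
    simp only [kernelDiff_mul_invStepFun]
    rw [integral_ofReal_mul_stepFun, inner_sub_right, inner_invStepVec, inner_invStepVec,
      ← intervalIntegral.integral_interval_sub_left (hi x 0 q) (hi x 0 p)]
    push_cast
    ring

end elements
end FracBM

namespace FracBM

open Filter Topology OnePoint Matrix

/-! ### Möbius transformations normalizing three points -/

theorem mk_smul_onePoint (g : GL (Fin 2) ℝ) (x : OnePoint ℝ) : ProjGenLinGroup.mk g • x = g • x :=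
  rfl

/-- The affine map `x ↦ (x - p) / (q - p)`. -/
noncomputable def affineGL (p q : ℝ) (h : q ≠ p) : GL (Fin 2) ℝ :=
  GeneralLinearGroup.mkOfDetNeZero !![1, -p; 0, q - p] (by
    simpa [det_fin_two] using sub_ne_zero.mpr h)

/-- A Möbius transformation sending `γ` to `∞`: the identity for `γ = ∞` and
`x ↦ (x - γ)⁻¹` otherwise. -/
noncomputable def chartGL (γ : OnePoint ℝ) : GL (Fin 2) ℝ :=
  γ.elim 1 fun c => GeneralLinearGroup.mkOfDetNeZero !![0, 1; 1, -c] (by simp [det_fin_two])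

/-- The coordinate given by `chartGL γ`. -/
noncomputable def chart (γ t : OnePoint ℝ) : ℝ := finitePart (chartGL γ • t)

theorem finitePart_coe (x : ℝ) : finitePart (x : OnePoint ℝ) = x := rfl

theorem coe_finitePart {x : OnePoint ℝ} (hx : x ≠ ∞) : ((finitePart x : ℝ) : OnePoint ℝ) = x := by
  induction x using OnePoint.rec with
  | infty => exact absurd rfl hx
  | coe x => rfl

theorem chartGL_infty : chartGL ∞ = 1 := rfl

theorem chartGL_smul_self (γ : OnePoint ℝ) : chartGL γ • γ = ∞ := by
  induction γ using OnePoint.rec with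
  | infty => rw [chartGL_infty, one_smul]
  | coe c =>
    simp [chartGL, GeneralLinearGroup.mkOfDetNeZero, smul_some_eq_ite]

theorem coe_chart {γ t : OnePoint ℝ} (h : t ≠ γ) : ((chart γ t : ℝ) : OnePoint ℝ) = chartGL γ • t :=
  coe_finitePart fun he => h (smul_left_cancel _ (he.trans (chartGL_smul_self γ).symm))

theorem chart_injective {γ s t : OnePoint ℝ} (hs : s ≠ γ) (ht : t ≠ γ) (h : chart γ s = chart γ t) :
    s = t := by
  have := coe_chart hs
  rw [h, coe_chart ht] at this
  exact (smul_left_cancel _ this).symm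

theorem affineGL_smul_coe {p q : ℝ} (h : q ≠ p) (x : ℝ) :
    affineGL p q h • (x : OnePoint ℝ) = (((x - p) / (q - p) : ℝ) : OnePoint ℝ) := by
  simp [affineGL, GeneralLinearGroup.mkOfDetNeZero, smul_some_eq_ite, sub_ne_zero.mpr h,
    ← sub_eq_add_neg]

theorem affineGL_smul_infty {p q : ℝ} (h : q ≠ p) : affineGL p q h • (∞ : OnePoint ℝ) = ∞ := by
  simp [affineGL, GeneralLinearGroup.mkOfDetNeZero, smul_infty_eq_ite]

/-- This factorization makes `g_t` explicit; only the affine factor depends on `α` and `t`. -/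
theorem normalizes_affineGL_mul_chartGL {α t γ : OnePoint ℝ} (hα : α ≠ γ) (ht : t ≠ γ)
    (h : chart γ t ≠ chart γ α) :
    Normalizes (ProjGenLinGroup.mk (affineGL (chart γ α) (chart γ t) h * chartGL γ)) α t γ := by
  refine ⟨?_, ?_, ?_⟩
  · rw [mk_smul_onePoint, mul_smul, ← coe_chart hα, affineGL_smul_coe, sub_self, zero_div]
  · rw [mk_smul_onePoint, mul_smul, ← coe_chart ht, affineGL_smul_coe,
      div_self (sub_ne_zero.mpr h)]
  · rw [mk_smul_onePoint, mul_smul, chartGL_smul_self, affineGL_smul_infty]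

theorem eq_one_of_fixes {g : PGL(2, ℝ)}
    (hg : Normalizes g ((0 : ℝ) : OnePoint ℝ) ((1 : ℝ) : OnePoint ℝ) ∞) : g = 1 := by
  obtain ⟨A, rfl⟩ := ProjGenLinGroup.mk_surjective g
  obtain ⟨h0, h1, hi⟩ := hg
  rw [mk_smul_onePoint] at h0 h1 hi
  have h10 : A 1 0 = 0 := smul_infty_eq_self_iff.mp hi
  have hdet : A 0 0 * A 1 1 ≠ 0 := by
    have := A.det_ne_zero
    rwa [det_fin_two, h10, mul_zero, sub_zero] at this
  have h11 : A 1 1 ≠ 0 := right_ne_zero_of_mul hdet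
  rw [smul_some_eq_ite, h10] at h0 h1
  simp only [mul_zero, zero_add, h11, if_false, mul_one, OnePoint.coe_eq_coe,
    div_eq_zero_iff, or_false, div_eq_one_iff_eq h11] at h0 h1
  rw [h0, add_zero] at h1
  rw [ProjGenLinGroup.mk_eq_one, GeneralLinearGroup.center_eq_range_scalar]
  refine ⟨Units.mk0 (A 1 1) h11, ?_⟩
  ext i j
  fin_cases i <;> fin_cases j <;> simp [h0, h1, h10]

theorem Normalizes.unique {g g' : PGL(2, ℝ)} {α t γ : OnePoint ℝ} (h : Normalizes g α t γ)
    (h' : Normalizes g' α t γ) : g = g' := by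
  have : g * g'⁻¹ = 1 := eq_one_of_fixes
    ⟨by rw [mul_smul, ← h'.1, inv_smul_smul, h.1, h'.1],
      by rw [mul_smul, ← h'.2.1, inv_smul_smul, h.2.1, h'.2.1],
      by rw [mul_smul, ← h'.2.2, inv_smul_smul, h.2.2, h'.2.2]⟩
  exact mul_inv_eq_one.mp this

theorem Normalizes.mobius_eq {g : PGL(2, ℝ)} {α t γ : OnePoint ℝ} (h : Normalizes g α t γ) :
    mobius α t γ = g :=
  (Classical.epsilon_spec (p := fun g => Normalizes g α t γ) ⟨g, h⟩).unique h

theorem exists_normalizes {α t γ : OnePoint ℝ} (hα : α ≠ γ) (htα : t ≠ α) (ht : t ≠ γ) :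
    ∃ g, Normalizes g α t γ :=
  ⟨_, normalizes_affineGL_mul_chartGL hα ht fun h => htα (chart_injective ht hα h)⟩

theorem mobius_normalizes {α t γ : OnePoint ℝ} (hα : α ≠ γ) (htα : t ≠ α) (ht : t ≠ γ) :
    Normalizes (mobius α t γ) α t γ :=
  Classical.epsilon_spec (p := fun g => Normalizes g α t γ) (exists_normalizes hα htα ht)

theorem mobius_smul {α t γ : OnePoint ℝ} (hα : α ≠ γ) (htα : t ≠ α) (ht : t ≠ γ)
    (h : GL (Fin 2) ℝ) :
    mobius (h • α) (h • t) (h • γ) = mobius α t γ * (ProjGenLinGroup.mk h)⁻¹ := by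
  have hn := mobius_normalizes hα htα ht
  refine Normalizes.mobius_eq ⟨?_, ?_, ?_⟩ <;>
    rw [← mk_smul_onePoint, mul_smul, inv_smul_smul]
  exacts [hn.1, hn.2.1, hn.2.2]

/-! ### The normalized covariance kernel -/

theorem normalizedCov_smul (H : ℝ) {α β γ : OnePoint ℝ} (hα : α ≠ γ) (hβα : β ≠ α) (hβ : β ≠ γ)
    (h : GL (Fin 2) ℝ) (s t : OnePoint ℝ) :
    normalizedCov H (h • α) (h • β) (h • γ) (h • s) (h • t) = normalizedCov H α β γ s t := by
  have hm : ∀ r, mobius (h • α) (h • β) (h • γ) • (h • r) = mobius α β γ • r := fun r => by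
    rw [mobius_smul hα hβα hβ, ← mk_smul_onePoint, mul_smul, inv_smul_smul]
  simp only [normalizedCov, transportedCov, hm]

/-- The point `β` enters only through the scale `c` of the affine map, and `|c| ^ (2H)` cancels
between numerator and square root. -/
theorem normalizedCov_eq {H : ℝ} (h0 : 0 < H) {α β γ s t : OnePoint ℝ} (hα : α ≠ γ) (hβα : β ≠ α)
    (hβ : β ≠ γ) (hs : s ≠ γ) (ht : t ≠ γ) :
    normalizedCov H α β γ s t = fbmCov H (chart γ s - chart γ α) (chart γ t - chart γ α) /
      (|chart γ s - chart γ α| ^ H * |chart γ t - chart γ α| ^ H) := by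
  have hb : chart γ β ≠ chart γ α := fun h => hβα (chart_injective hβ hα h)
  set c := (chart γ β - chart γ α)⁻¹ with hc
  have hc0 : c ≠ 0 := inv_ne_zero (sub_ne_zero.mpr hb)
  have hm : ∀ r, r ≠ γ → finitePart (mobius α β γ • r) = c * (chart γ r - chart γ α) :=
    fun r hr => by
      rw [(normalizes_affineGL_mul_chartGL hα hβ hb).mobius_eq, mk_smul_onePoint, mul_smul,
        ← coe_chart hr, affineGL_smul_coe, finitePart_coe, div_eq_inv_mul]
  have hsq : ∀ r : ℝ, |r| ^ (2 * H) = |r| ^ H * |r| ^ H := fun r => by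
    rw [← Real.rpow_add_of_nonneg (abs_nonneg r) h0.le h0.le]; congr 1; ring
  have hcp : |c| ^ (2 * H) ≠ 0 := (Real.rpow_pos_of_pos (abs_pos.mpr hc0) _).ne'
  simp only [normalizedCov, transportedCov, hm s hs, hm t ht, fbmCov_mul, fbmCov_self h0]
  generalize chart γ s - chart γ α = x
  generalize chart γ t - chart γ α = y
  have hroot : |c * x| ^ (2 * H) * |c * y| ^ (2 * H)
      = (|c| ^ (2 * H) * (|x| ^ H * |y| ^ H)) ^ 2 := by
    rw [abs_mul, abs_mul, Real.mul_rpow (abs_nonneg _) (abs_nonneg _),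
      Real.mul_rpow (abs_nonneg _) (abs_nonneg _), hsq x, hsq y]
    ring
  rw [hroot, Real.sqrt_sq (by positivity), mul_div_mul_left _ _ hcp]

/-! ### The functions `f_t` -/

section functions
variable {𝕜 : Type*} [RCLike 𝕜]

theorem det_inv_GL (g : GL (Fin 2) ℝ) : (g⁻¹).1.det = (g.1.det)⁻¹ := by
  refine eq_inv_of_mul_eq_one_left ?_
  rw [← det_mul, ← Units.val_mul, inv_mul_cancel, Units.val_one, det_one]

theorem mobiusOp_inv_indicator (H : ℝ) (g : GL (Fin 2) ℝ) (x : ℝ) :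
    mobiusOp H g⁻¹ (indicator (Icc (0 : ℝ) 1) fun _ => (1 : 𝕜)) x =
      ((Real.sign g.1.det * (|g.1.det| ^ H / |g 1 0 * x + g 1 1| ^ (2 * H)) *
        indicator (Icc (0 : ℝ) 1) (fun _ => (1 : ℝ))
          ((g 0 0 * x + g 0 1) / (g 1 0 * x + g 1 1)) : ℝ) : 𝕜) := by
  have hs : Real.sign (g⁻¹).1.det = Real.sign g.1.det := by rw [det_inv_GL, Real.sign_inv]
  rw [mobiusOp, hs, inv_inv]
  by_cases h : (g 0 0 * x + g 0 1) / (g 1 0 * x + g 1 1) ∈ Icc (0 : ℝ) 1 <;> simp [h]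

theorem fFun_eq (H : ℝ) {α γ t : OnePoint ℝ} {g : GL (Fin 2) ℝ}
    (hg : ProjGenLinGroup.mk g = mobius α t γ) (x : ℝ) :
    fFun 𝕜 H α γ t x =
      ((Real.sign g.1.det * (|g.1.det| ^ H / |g 1 0 * x + g 1 1| ^ (2 * H)) *
        indicator (Icc (0 : ℝ) 1) (fun _ => (1 : ℝ))
          ((g 0 0 * x + g 0 1) / (g 1 0 * x + g 1 1)) : ℝ) : 𝕜) := by
  rw [fFun, ← hg, ← map_inv, mobiusOpPGL_mk, mobiusOp_inv_indicator]

theorem fFun_eq_indicator {H : ℝ} (h0 : 0 < H) {α γ t : OnePoint ℝ} {g : GL (Fin 2) ℝ}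
    (hg : ProjGenLinGroup.mk g = mobius α t γ) (x : ℝ) :
    fFun 𝕜 H α γ t x =
      ((Real.sign g.1.det * (|g.1.det| ^ H / |g 1 0 * x + g 1 1| ^ (2 * H)) *
        indicator {y : ℝ | g • (y : OnePoint ℝ) ∈ ((↑) : ℝ → OnePoint ℝ) '' Icc (0 : ℝ) 1}
          (fun _ => (1 : ℝ)) x : ℝ) : 𝕜) := by
  rw [fFun_eq H hg]
  -- At the pole the weight is a division by `0 ^ (2H) = 0`, hence `0`, whatever the indicator
  -- function gives.
  by_cases hd : g 1 0 * x + g 1 1 = 0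
  · rw [hd, abs_zero, Real.zero_rpow (by linarith)]
    simp
  · congr 2
    have hm : x ∈ {y : ℝ | g • (y : OnePoint ℝ) ∈ ((↑) : ℝ → OnePoint ℝ) '' Icc (0 : ℝ) 1} ↔
        (g 0 0 * x + g 0 1) / (g 1 0 * x + g 1 1) ∈ Icc (0 : ℝ) 1 := by
      rw [mem_ofPred_eq, smul_some_eq_ite, if_neg hd]
      exact OnePoint.coe_injective.mem_set_image
    by_cases h : (g 0 0 * x + g 0 1) / (g 1 0 * x + g 1 1) ∈ Icc (0 : ℝ) 1
    · rw [indicator_of_mem h, indicator_of_mem (hm.mpr h)]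
    · rw [indicator_of_notMem h, indicator_of_notMem fun h' => h (hm.mp h')]

theorem GL_row_ne_zero (g : GL (Fin 2) ℝ) : g 1 0 ≠ 0 ∨ g 1 1 ≠ 0 := by
  by_contra! h
  exact g.det_ne_zero (by rw [det_fin_two, h.1, h.2]; ring)

theorem ae_denom_ne_zero (g : GL (Fin 2) ℝ) : ∀ᵐ x : ℝ, g 1 0 * x + g 1 1 ≠ 0 := by
  have hn : ∀ᵐ x : ℝ, x ≠ -g 1 1 / g 1 0 := by simp [ae_iff, measure_singleton]
  filter_upwards [hn] with x hx h
  rcases eq_or_ne (g 1 0) 0 with h10 | h10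
  · rw [h10, zero_mul, zero_add] at h
    exact (GL_row_ne_zero g).elim (fun k => k h10) fun k => k h
  · exact hx (by field_simp; linarith)

/-- This is the cocycle identity for the denominators. It is asserted off the pole of `g⁻¹`, where
division by zero would spoil the composition. -/
theorem mobiusOp_mul_ae (H : ℝ) (g h : GL (Fin 2) ℝ) (ξ : ℝ → 𝕜) :
    mobiusOp H g (mobiusOp H h ξ) =ᵐ[volume] mobiusOp H (g * h) ξ := by
  filter_upwards [ae_denom_ne_zero g⁻¹] with x hx
  simp only [mobiusOp, _root_.mul_inv_rev]
  have hsign : Real.sign (g * h).1.det = Real.sign g.1.det * Real.sign h.1.det := by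
    rw [Units.val_mul, det_mul, realSign_mul]
  have hdet : (h⁻¹ * g⁻¹).1.det = (h⁻¹).1.det * (g⁻¹).1.det := by
    rw [Units.val_mul, det_mul]
  have hent : ∀ i j, (h⁻¹ * g⁻¹) i j = h⁻¹ i 0 * g⁻¹ 0 j + h⁻¹ i 1 * g⁻¹ 1 j := fun i j => by
    rw [GeneralLinearGroup.coe_mul, mul_apply, Fin.sum_univ_two]
  rw [hsign, hdet]
  simp only [hent]
  generalize g⁻¹ = A at *
  generalize h⁻¹ = B at *
  set y := (A 0 0 * x + A 0 1) / (A 1 0 * x + A 1 1) with hy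
  have hrow : ∀ i, (B i 0 * A 0 0 + B i 1 * A 1 0) * x + (B i 0 * A 0 1 + B i 1 * A 1 1)
      = (A 1 0 * x + A 1 1) * (B i 0 * y + B i 1) := fun i => by
    rw [hy]; field_simp; ring
  rw [hrow, hrow, mul_div_mul_left _ _ hx, abs_mul, abs_mul,
    Real.mul_rpow (abs_nonneg _) (abs_nonneg _), Real.mul_rpow (abs_nonneg _) (abs_nonneg _),
    ← mul_assoc, ← RCLike.ofReal_mul]
  congr 2
  ring

theorem mobiusOp_fFun_ae (H : ℝ) {α γ t : OnePoint ℝ} (hα : α ≠ γ) (htα : t ≠ α) (ht : t ≠ γ)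
    (h : GL (Fin 2) ℝ) :
    mobiusOp H h (fFun 𝕜 H α γ t) =ᵐ[volume] fFun 𝕜 H (h • α) (h • γ) (h • t) := by
  obtain ⟨g, hg⟩ := ProjGenLinGroup.mk_surjective (mobius α t γ)
  rw [fFun, fFun, mobius_smul hα htα ht, ← hg, _root_.mul_inv_rev, inv_inv, ← map_inv, ← map_mul,
    mobiusOpPGL_mk, mobiusOpPGL_mk]
  exact mobiusOp_mul_ae H h g⁻¹ _

/-! ### The functions `f_t` as elements of `𝓗_H` -/

/-- The endpoints are excluded because `stepFun` uses half-open intervals while `f_t` comes from the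
closed interval `[0, 1]`. -/
theorem stepFun_eq {p q y : ℝ} (hpq : q ≠ p) (hp : y ≠ p) (hq : y ≠ q) :
    stepFun 𝕜 p q y = ((Real.sign (q - p) * indicator (Icc (0 : ℝ) 1) (fun _ => (1 : ℝ))
      ((y - p) / (q - p)) : ℝ) : 𝕜) := by
  rcases lt_or_gt_of_ne hpq with h | h
  · have hm : (y - p) / (q - p) ∈ Icc (0 : ℝ) 1 ↔ y ∈ uIoc p q := by
      have hd : q - p < 0 := by linarith
      rw [mem_Icc, div_le_one_of_neg hd, uIoc_of_ge h.le, mem_Ioc, div_nonneg_iff]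
      constructor
      · rintro ⟨h1, h2⟩
        refine ⟨lt_of_le_of_ne (by linarith) hq.symm, ?_⟩
        rcases h1 with h1 | h1 <;> linarith [h1.1, h1.2]
      · rintro ⟨h1, h2⟩
        exact ⟨Or.inr ⟨by linarith, hd.le⟩, by linarith⟩
    rw [Real.sign_of_neg (by linarith), stepFun]
    by_cases hy : y ∈ uIoc p q
    · rw [indicator_of_mem hy, indicator_of_mem (hm.mpr hy), if_neg (by linarith)]
      simp
    · rw [indicator_of_notMem hy, indicator_of_notMem fun k => hy (hm.mp k)]
      simp
  · have hm : (y - p) / (q - p) ∈ Icc (0 : ℝ) 1 ↔ y ∈ uIoc p q := by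
      have hd : 0 < q - p := by linarith
      rw [mem_Icc, div_le_one hd, uIoc_of_le h.le, mem_Ioc, le_div_iff₀ hd, zero_mul]
      constructor
      · rintro ⟨h1, h2⟩
        exact ⟨lt_of_le_of_ne (by linarith) hp.symm, by linarith⟩
      · rintro ⟨h1, h2⟩
        exact ⟨by linarith, by linarith⟩
    rw [Real.sign_of_pos (by linarith), stepFun]
    by_cases hy : y ∈ uIoc p q
    · rw [indicator_of_mem hy, indicator_of_mem (hm.mpr hy), if_pos h.le]
      simp
    · rw [indicator_of_notMem hy, indicator_of_notMem fun k => hy (hm.mp k)]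
      simp

variable {H : Ioo (0 : ℝ) 1}

variable (𝕜 H) in
/-- The curve in `𝓗_H` whose increments are, up to normalization, the functions `f_t`, in the
coordinate given by `chartGL γ`. -/
noncomputable def chartVec (γ : OnePoint ℝ) (u : ℝ) : HSpace 𝕜 H :=
  γ.elim (stepVec 𝕜 H u) fun c => -invStepVec 𝕜 H c u

theorem chartVec_isFBMCurve (γ : OnePoint ℝ) : IsFBMCurve 𝕜 H (chartVec 𝕜 H γ) := by
  induction γ using OnePoint.rec with
  | infty => exact stepVec_isFBMCurve
  | coe c =>
    intro u v
    change inner 𝕜 (-invStepVec 𝕜 H c u) (-invStepVec 𝕜 H c v) = _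
    rw [inner_neg_neg, invStepVec_isFBMCurve]

variable (𝕜 H) in
/-- The function `f_t` as an element of `𝓗_H`. -/
noncomputable def fVec (α γ t : OnePoint ℝ) : HSpace 𝕜 H :=
  ((|chart γ t - chart γ α| ^ (-(H : ℝ)) : ℝ) : 𝕜) •
    (chartVec 𝕜 H γ (chart γ t) - chartVec 𝕜 H γ (chart γ α))

theorem rpow_div_rpow_two_mul {H x : ℝ} (hx : 0 < x) : x ^ H / x ^ (2 * H) = x ^ (-H) := by
  rw [← Real.rpow_sub hx]
  congr 1
  ring

/-- With the explicit matrix of affine map times chart, `f_t` is computed off finitely many points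
as a multiple of a step or of an inverted step; the weight produces `|q - p| ^ H / |q - p| ^ (2H) =
|q - p| ^ (-H)`. -/
theorem isElement_fFun {α γ t : OnePoint ℝ} (hα : α ≠ γ) (htα : t ≠ α) (ht : t ≠ γ) :
    IsElement (fFun 𝕜 H α γ t) (fVec 𝕜 H α γ t) := by
  have hpq : chart γ t ≠ chart γ α := fun h => htα (chart_injective ht hα h)
  have hg := (normalizes_affineGL_mul_chartGL hα ht hpq).mobius_eq.symm
  have hf := fun x => fFun_eq (𝕜 := 𝕜) (H : ℝ) hg x
  rw [fVec]
  generalize chart γ t = q at *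
  generalize chart γ α = p at *
  have hd : 0 < |q - p| := abs_pos.mpr (sub_ne_zero.mpr hpq)
  have hp : ∀ᵐ x : ℝ, x ≠ p := by simp [ae_iff, measure_singleton]
  have hq : ∀ᵐ x : ℝ, x ≠ q := by simp [ae_iff, measure_singleton]
  induction γ using OnePoint.rec with
  | infty =>
    refine (((isStepElement_stepFun p q).const_smul _).congr ?_).isElement
    filter_upwards [hp, hq] with x hxp hxq
    have hdet : (affineGL p q hpq * chartGL ∞).1.det = q - p := by
      simp [affineGL, chartGL_infty, GeneralLinearGroup.mkOfDetNeZero, det_fin_two]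
    have h00 : (affineGL p q hpq * chartGL ∞) 0 0 = 1 := by
      simp [affineGL, chartGL_infty, GeneralLinearGroup.mkOfDetNeZero]
    have h01 : (affineGL p q hpq * chartGL ∞) 0 1 = -p := by
      simp [affineGL, chartGL_infty, GeneralLinearGroup.mkOfDetNeZero]
    have h10 : (affineGL p q hpq * chartGL ∞) 1 0 = 0 := by
      simp [affineGL, chartGL_infty, GeneralLinearGroup.mkOfDetNeZero]
    have h11 : (affineGL p q hpq * chartGL ∞) 1 1 = q - p := by
      simp [affineGL, chartGL_infty, GeneralLinearGroup.mkOfDetNeZero]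
    rw [hf, hdet, h00, h01, h10, h11, one_mul, zero_mul, zero_add, ← sub_eq_add_neg,
      stepFun_eq hpq hxp hxq, ← RCLike.ofReal_mul, rpow_div_rpow_two_mul hd]
    congr 1
    ring
  | coe c =>
    -- The chart at a finite point has determinant `-1`, so the sign of `det g` is opposite to the
    -- orientation of the step; the minus sign in `chartVec` accounts for this.
    have hstep := (isStepElement_invStepFun (𝕜 := 𝕜) (H := H) c p q).const_smul
      (-((|q - p| ^ (-(H : ℝ)) : ℝ) : 𝕜))
    have hvec : ((|q - p| ^ (-(H : ℝ)) : ℝ) : 𝕜) • (chartVec 𝕜 H c q - chartVec 𝕜 H c p)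
        = (-((|q - p| ^ (-(H : ℝ)) : ℝ) : 𝕜)) • (invStepVec 𝕜 H c q - invStepVec 𝕜 H c p) := by
      change _ • (-invStepVec 𝕜 H c q - -invStepVec 𝕜 H c p) = _
      rw [neg_smul, ← smul_neg]
      congr 1
      abel
    rw [hvec]
    refine (hstep.congr ?_).isElement
    have hc : ∀ᵐ x : ℝ, x ≠ c := by simp [ae_iff, measure_singleton]
    have hp' : ∀ᵐ x : ℝ, x ≠ c + p⁻¹ := by simp [ae_iff, measure_singleton]
    have hq' : ∀ᵐ x : ℝ, x ≠ c + q⁻¹ := by simp [ae_iff, measure_singleton]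
    filter_upwards [hc, hp', hq'] with x hxc hxp hxq
    have hxc' : x - c ≠ 0 := sub_ne_zero.mpr hxc
    have hdet : (affineGL p q hpq * chartGL c).1.det = -(q - p) := by
      simp [affineGL, chartGL, GeneralLinearGroup.mkOfDetNeZero, det_fin_two]
      ring
    have h00 : (affineGL p q hpq * chartGL c) 0 0 = -p := by
      simp [affineGL, chartGL, GeneralLinearGroup.mkOfDetNeZero]
    have h01 : (affineGL p q hpq * chartGL c) 0 1 = 1 + p * c := by
      simp [affineGL, chartGL, GeneralLinearGroup.mkOfDetNeZero]
    have h10 : (affineGL p q hpq * chartGL c) 1 0 = q - p := by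
      simp [affineGL, chartGL, GeneralLinearGroup.mkOfDetNeZero]
    have h11 : (affineGL p q hpq * chartGL c) 1 1 = -((q - p) * c) := by
      simp [affineGL, chartGL, GeneralLinearGroup.mkOfDetNeZero]
    have hden : (q - p) * x + -((q - p) * c) = (q - p) * (x - c) := by ring
    have hnum : (-p * x + (1 + p * c)) / ((q - p) * (x - c)) = ((x - c)⁻¹ - p) / (q - p) := by
      have := sub_ne_zero.mpr hpq
      field_simp
      ring
    have hyp : (x - c)⁻¹ ≠ p := fun h => hxp (by rw [← h, inv_inv]; ring)
    have hyq : (x - c)⁻¹ ≠ q := fun h => hxq (by rw [← h, inv_inv]; ring)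
    rw [hf, hdet, h00, h01, h10, h11, hden, hnum, invStepFun, stepFun_eq hpq hyp hyq,
      Real.sign_neg, abs_neg, abs_mul, Real.mul_rpow (abs_nonneg _) (abs_nonneg _),
      ← div_div, rpow_div_rpow_two_mul hd, Real.rpow_neg (abs_nonneg (x - c)),
      ← RCLike.ofReal_neg, ← RCLike.ofReal_mul, ← RCLike.ofReal_mul]
    congr 1
    ring

/-- Both vectors are scaled increments of one curve from the same base point, so stationarity of
increments applies. -/
theorem inner_fVec {α γ s t : OnePoint ℝ} :
    inner 𝕜 (fVec 𝕜 H α γ s) (fVec 𝕜 H α γ t)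
      = ((fbmCov H (chart γ s - chart γ α) (chart γ t - chart γ α) /
        (|chart γ s - chart γ α| ^ (H : ℝ) * |chart γ t - chart γ α| ^ (H : ℝ)) : ℝ) : 𝕜) := by
  have h := (chartVec_isFBMCurve (𝕜 := 𝕜) (H := H) γ).sub_const H.2.1 (chart γ α)
    (chart γ s - chart γ α) (chart γ t - chart γ α)
  simp only [add_sub_cancel] at h
  rw [fVec, fVec, inner_smul_left, inner_smul_right, RCLike.conj_ofReal, h, ← RCLike.ofReal_mul,
    ← RCLike.ofReal_mul, Real.rpow_neg (abs_nonneg _), Real.rpow_neg (abs_nonneg _)]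
  congr 1
  rw [div_eq_mul_inv, mul_inv]
  ring

theorem norm_fVec {α γ t : OnePoint ℝ} (hα : α ≠ γ) (htα : t ≠ α) (ht : t ≠ γ) :
    ‖fVec 𝕜 H α γ t‖ = 1 := by
  have hpq : chart γ t ≠ chart γ α := fun h => htα (chart_injective ht hα h)
  have h := ((chartVec_isFBMCurve (𝕜 := 𝕜) (H := H) γ).sub_const H.2.1 (chart γ α)).norm_eq H.2.1
    (chart γ t - chart γ α)
  simp only [add_sub_cancel] at h
  have hd : 0 < |chart γ t - chart γ α| := abs_pos.mpr (sub_ne_zero.mpr hpq)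
  rw [fVec, norm_smul, h, RCLike.norm_ofReal, abs_of_pos (Real.rpow_pos_of_pos hd _),
    ← Real.rpow_add hd, neg_add_cancel, Real.rpow_zero]

end functions
end FracBM

/-! ### The theorem -/

theorem mainTheorem3 {𝕜 : Type*} [RCLike 𝕜] (H : Set.Ioo (0 : ℝ) 1)
    (α γ : OnePoint ℝ) (hαγ : α ≠ γ) :
    -- existence and uniqueness of `g_t`
    (∀ t, t ≠ α → t ≠ γ → ∃! g : PGL(2, ℝ), FracBM.Normalizes g α t γ) ∧
    -- the explicit formula for `f_t`, for every matrix representing `g_t`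
    (∀ t, t ≠ α → t ≠ γ → ∀ g : GL (Fin 2) ℝ,
      Matrix.ProjGenLinGroup.mk g = FracBM.mobius α t γ →
      ∀ x : ℝ, FracBM.fFun 𝕜 H α γ t x =
        ((Real.sign g.1.det * (|g.1.det| ^ (H : ℝ) / |g 1 0 * x + g 1 1| ^ (2 * (H : ℝ))) *
          Set.indicator
            {y : ℝ | g • (y : OnePoint ℝ) ∈ ((↑) : ℝ → OnePoint ℝ) '' Set.Icc (0 : ℝ) 1}
            (fun _ => (1 : ℝ)) x : ℝ) : 𝕜)) ∧
    -- the `f_t` are unit vectors of the Hilbert space, with scalar products `C^H_{α,γ}(s, t)`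
    (∃ F : OnePoint ℝ → FracBM.HSpace 𝕜 H,
      (∀ t, t ≠ α → t ≠ γ → FracBM.IsElement (FracBM.fFun 𝕜 H α γ t) (F t) ∧
        ∀ v, FracBM.IsElement (FracBM.fFun 𝕜 H α γ t) v → v = F t) ∧
      (∀ t, t ≠ α → t ≠ γ → ‖F t‖ = 1) ∧
      (∀ β, β ≠ α → β ≠ γ → ∀ s t, s ≠ α → s ≠ γ → t ≠ α → t ≠ γ →
        inner 𝕜 (F s) (F t) = ((FracBM.normalizedCov H α β γ s t : ℝ) : 𝕜)) ∧
      -- the associated Gaussian process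
      (∀ (Ω : Type*) [MeasurableSpace Ω] (P : MeasureTheory.Measure Ω)
        [MeasureTheory.IsProbabilityMeasure P] (φ : FracBM.HSpace 𝕜 H → Ω → 𝕜),
        FracBM.IsHilbertGaussian φ P →
        ProbabilityTheory.IsGaussianProcess
          (fun t : {t : OnePoint ℝ // t ≠ α ∧ t ≠ γ} => φ (F t)) P ∧
        (∀ t, t ≠ α → t ≠ γ → ∫ ω, φ (F t) ω ∂P = 0) ∧
        (∀ β, β ≠ α → β ≠ γ → ∀ s t, s ≠ α → s ≠ γ → t ≠ α → t ≠ γ →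
          ∫ ω, φ (F s) ω * (starRingEnd 𝕜) (φ (F t) ω) ∂P =
            ((FracBM.normalizedCov H α β γ s t : ℝ) : 𝕜)))) ∧
    -- covariance under `GL₂(ℝ)`
    (∀ (h : GL (Fin 2) ℝ) (t), t ≠ α → t ≠ γ →
      FracBM.mobiusOp H h (FracBM.fFun 𝕜 H α γ t) =ᵐ[MeasureTheory.volume]
        FracBM.fFun 𝕜 H (h • α) (h • γ) (h • t)) ∧
    (∀ (h : GL (Fin 2) ℝ) (β), β ≠ α → β ≠ γ →
      ∀ s t, s ≠ α → s ≠ γ → t ≠ α → t ≠ γ →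
      FracBM.normalizedCov H (h • α) (h • β) (h • γ) (h • s) (h • t) =
        FracBM.normalizedCov H α β γ s t) ∧
    -- for `(α, γ) = (0, ∞)` the kernel is the covariance of `|t| ^ (-H) * B_t`
    (∀ β : OnePoint ℝ, β ≠ ((0 : ℝ) : OnePoint ℝ) → β ≠ OnePoint.infty →
      ∀ s t : ℝ, s ≠ 0 → t ≠ 0 →
      FracBM.normalizedCov H ((0 : ℝ) : OnePoint ℝ) β OnePoint.infty
          (s : OnePoint ℝ) (t : OnePoint ℝ) =
        FracBM.fbmCov H s t / (|s| ^ (H : ℝ) * |t| ^ (H : ℝ))) := by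
  refine ⟨fun t htα ht => ?_, fun t _ _ g hg x => FracBM.fFun_eq_indicator H.2.1 hg x,
    ⟨FracBM.fVec 𝕜 H α γ, fun t htα ht => ?_, fun t htα ht => FracBM.norm_fVec hαγ htα ht,
      fun β hβα hβ s t _ hs _ ht => ?_, fun Ω _ P _ φ hφ => ⟨?_, fun t _ _ => hφ.mean_zero _,
        fun β hβα hβ s t _ hs _ ht => ?_⟩⟩,
    fun h t htα ht => FracBM.mobiusOp_fFun_ae H hαγ htα ht h,
    fun h β hβα hβ s t _ _ _ _ => FracBM.normalizedCov_smul H hαγ hβα hβ h s t,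
    fun β hβα hβ s t _ _ => ?_⟩
  · obtain ⟨g, hg⟩ := FracBM.exists_normalizes hαγ htα ht
    exact ⟨g, hg, fun g' hg' => hg'.unique hg⟩
  · have hF := FracBM.isElement_fFun (𝕜 := 𝕜) (H := H) hαγ htα ht
    exact ⟨hF, fun v hv => hv.unique hF⟩
  · rw [FracBM.inner_fVec, FracBM.normalizedCov_eq H.2.1 hαγ hβα hβ hs ht]
  -- Reindexing a Gaussian process along any map of index sets leaves it Gaussian.
  · exact hφ.gaussian.comp_right fun t : {t : OnePoint ℝ // t ≠ α ∧ t ≠ γ} => FracBM.fVec 𝕜 H α γ t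
  · rw [hφ.covariance, FracBM.inner_fVec, FracBM.normalizedCov_eq H.2.1 hαγ hβα hβ hs ht]
  -- For `γ = ∞` the chart is the identity and `α = 0` has coordinate `0`, so the general formula
  -- for the kernel specializes directly.
  · have hc : ∀ r : ℝ, FracBM.chart OnePoint.infty (r : OnePoint ℝ) = r := fun r => by
      rw [FracBM.chart, FracBM.chartGL_infty, one_smul, FracBM.finitePart_coe]
    rw [FracBM.normalizedCov_eq H.2.1 (OnePoint.coe_ne_infty 0) hβα hβ (OnePoint.coe_ne_infty s)
      (OnePoint.coe_ne_infty t), hc, hc, hc, sub_zero, sub_zero]
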